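/- Throughout, a trace on a von Neumann algebra is a normal, faithful, finite trace $\tau$ with $\tau(1)=1$, and $\|x\|_2=\tau(x^*x)^{1/2}$. Let $B$ be a von Neumann algebra acting on a Hilbert space $K$, let $\tau$ be a trace on $B$ (so that $B$ is finite), and let $\alpha$ be an action of a (discrete) abelian group $\Gamma_0$ on $B$ by $*$-automorphisms with $\tau\circ\alpha_g=\tau$ for all $g\in\Gamma_0$. Let $M=B\rtimes_\alpha\Gamma_0$ be the crossed product, that is, the von Neumann algebra on $\ell^2(\Gamma_0,K)$ generated by the operators $(\pi(b)\xi)(g)=\alpha_{g^{-1}}(b)\xi(g)$, $b\in B$, and $(\lambda(h)\xi)(g)=\xi(h^{-1}g)$, $h\in\Gamma_0$. Equip $M$ with the trace, still denoted by $\tau$, that sends $x=\sum_\gamma \pi(x(\gamma))\lambda(\gamma)$ to $\tau(x(1))$. Let $A=L(\Gamma_0)\subset M$ be the abelian von Neumann subalgebra generated by $\lambda(\Gamma_0)$, and let $E_A$ be the $\tau$-preserving conditional expectation of $M$ onto $A$, characterised by $E_A(x)\in A$ and $\tau(E_A(x)a)=\tau(xa)$ for all $x\in M$, $a\in A$. An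 infinite set $S$ of unitaries of $M$ is called almost orthonormal if for every $x\in M$ and every $\varepsilon>0$ there is a finite set $F\subset S$ with $|\tau(ux)|\le\varepsilon$ for all $u\in S\setminus F$. The subalgebra $A$ is called strongly mixing in $M$ if for every almost orthonormal infinite subgroup $G$ of the unitary group of $A$ and all $x,y\in M$, $$\lim_{u\to\infty,\ u\in G}\|E_A(uxu^{-1}y)-E_A(x)E_A(y)\|_2=0,$$ where the limit is taken along the complements of the finite subsets of $G$. The action $\alpha$ is called strongly mixing if for every finite set $F\subset B$ and every $\varepsilon>0$ there is a finite set $E\subset\Gamma_0$ such that $|\tau(\alpha_g(a)b)-\tau(a)\tau(b)|<\varepsilon$ for all $a,b\in F$ and all $g\in\Gamma_0\setminus E$. Then $A=L(\Gamma_0)$ is strongly mixing in $M=B\rtimes_\alpha\Gamma_0$ if and only if the action $\alpha$ of $\Gamma_0$ on $B$ is strongly mixing. -/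

import Mathlib

namespace CrossedMixing

open Filter Topology
open scoped ENNReal ComplexOrder

noncomputable section

/-! ### Von Neumann algebras, traces, conditional expectations, strong mixing -/

section General

variable {H : Type*} [NormedAddCommGroup H] [InnerProductSpace ℂ H] [CompleteSpace H]

/-- The von Neumann algebra `(S ∪ S*)''` generated by a set `S` of bounded operators on `H`. -/
def generatedBy (S : Set (H →L[ℂ] H)) : VonNeumannAlgebra H where
  toStarSubalgebra := StarSubalgebra.centralizer ℂ (StarSubalgebra.centralizer ℂ S : Set (H →L[ℂ] H))
  centralizer_centralizer' := by
    change Set.centralizer (Set.centralizer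
      ((StarSubalgebra.centralizer ℂ (StarSubalgebra.centralizer ℂ S : Set (H →L[ℂ] H)) :
        StarSubalgebra ℂ (H →L[ℂ] H)) : Set (H →L[ℂ] H))) =
      ((StarSubalgebra.centralizer ℂ (StarSubalgebra.centralizer ℂ S : Set (H →L[ℂ] H)) :
        StarSubalgebra ℂ (H →L[ℂ] H)) : Set (H →L[ℂ] H))
    rw [StarSubalgebra.coe_centralizer_centralizer, Set.centralizer_centralizer_centralizer]

/-- A linear functional on a von Neumann algebra is normal if it is ultraweakly continuous, i.e.
of the form `x ↦ ∑ₙ ⟪ηₙ, x ξₙ⟫` with `∑ ‖ξₙ‖² < ∞` and `∑ ‖ηₙ‖² < ∞`. -/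
def IsNormalFunctional (M : VonNeumannAlgebra H) (φ : M.toStarSubalgebra →ₗ[ℂ] ℂ) : Prop :=
  ∃ ξ η : ℕ → H, Summable (fun n => ‖ξ n‖ ^ 2) ∧ Summable (fun n => ‖η n‖ ^ 2) ∧
    ∀ x : M.toStarSubalgebra,
      HasSum (fun n => inner ℂ (η n) ((x : H →L[ℂ] H) (ξ n))) (φ x)

/-- A trace on `M`: a normal, faithful, finite, normalised (`τ 1 = 1`) trace. -/
structure IsTrace (M : VonNeumannAlgebra H) (τ : M.toStarSubalgebra →ₗ[ℂ] ℂ) : Prop where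
  normal : IsNormalFunctional M τ
  nonneg : ∀ x, 0 ≤ τ (star x * x)
  faithful : ∀ x, τ (star x * x) = 0 → x = 0
  tracial : ∀ x y, τ (x * y) = τ (y * x)
  normalised : τ 1 = 1

/-- The norm `‖x‖₂ = τ(x* x)^{1/2}`. -/
def norm₂ {M : VonNeumannAlgebra H} (τ : M.toStarSubalgebra →ₗ[ℂ] ℂ)
    (x : M.toStarSubalgebra) : ℝ :=
  Real.sqrt (τ (star x * x)).re

/-- `E` is the `τ`-preserving conditional expectation of `M` onto its von Neumann subalgebra `A`,
characterised by `E x ∈ A` and `τ(E(x) a) = τ(x a)` for all `x ∈ M` and `a ∈ A`. -/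
def IsCondExp {M : VonNeumannAlgebra H} (τ : M.toStarSubalgebra →ₗ[ℂ] ℂ)
    (A : VonNeumannAlgebra H) (E : M.toStarSubalgebra → M.toStarSubalgebra) : Prop :=
  (∀ x, (E x : H →L[ℂ] H) ∈ A) ∧
    ∀ x a : M.toStarSubalgebra, (a : H →L[ℂ] H) ∈ A → τ (E x * a) = τ (x * a)

/-- An infinite set `S` of unitaries of `M` is almost orthonormal if for all `x ∈ M` and `ε > 0`,
`|τ(u x)| ≤ ε` for all `u ∈ S` outside a finite subset. -/
def AlmostOrthonormal {M : VonNeumannAlgebra H} (τ : M.toStarSubalgebra →ₗ[ℂ] ℂ)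
    (S : Set (unitary M.toStarSubalgebra)) : Prop :=
  S.Infinite ∧ ∀ x : M.toStarSubalgebra, ∀ ε : ℝ, 0 < ε →
    ∃ F : Set (unitary M.toStarSubalgebra), F.Finite ∧ F ⊆ S ∧
      ∀ u ∈ S \ F, ‖τ ((u : M.toStarSubalgebra) * x)‖ ≤ ε

/-- The action by conjugation of a group `G` of unitaries on `M` is strongly mixing relative to the
range of the conditional expectation `E`: for all `x, y ∈ M`,
`‖E(u x u⁻¹ y) - E(x) E(y)‖₂ → 0` as `u → ∞` in the discrete group `G`. -/
def StronglyMixingRel {M : VonNeumannAlgebra H} (τ : M.toStarSubalgebra →ₗ[ℂ] ℂ)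
    (E : M.toStarSubalgebra → M.toStarSubalgebra)
    (G : Subgroup (unitary M.toStarSubalgebra)) : Prop :=
  ∀ x y : M.toStarSubalgebra,
    Tendsto (fun u : G => norm₂ τ
      (E (((u : unitary M.toStarSubalgebra) : M.toStarSubalgebra) * x *
        (((u : unitary M.toStarSubalgebra)⁻¹ : unitary M.toStarSubalgebra) :
          M.toStarSubalgebra) * y) - E x * E y)) cofinite (𝓝 0)

/-- `A` is strongly mixing in `(M, τ)`: for every almost orthonormal infinite subgroup `G` of the
unitary group of `A`, the action of `G` on `M` by conjugation is strongly mixing relative to `A`.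
The conditional expectation onto `A` (unique, as `τ` is faithful) is asserted to exist. -/
def StronglyMixingIn {M : VonNeumannAlgebra H} (τ : M.toStarSubalgebra →ₗ[ℂ] ℂ)
    (A : VonNeumannAlgebra H) : Prop :=
  ∃ E : M.toStarSubalgebra → M.toStarSubalgebra, IsCondExp τ A E ∧
    ∀ G : Subgroup (unitary M.toStarSubalgebra),
      (∀ u ∈ G, ((u : M.toStarSubalgebra) : H →L[ℂ] H) ∈ A) →
      AlmostOrthonormal τ (G : Set (unitary M.toStarSubalgebra)) →
      StronglyMixingRel τ E G

/-- A von Neumann algebra is norm closed (so that it is a C*-algebra). -/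
theorem isClosed_coe (M : VonNeumannAlgebra H) :
    IsClosed (M.toStarSubalgebra : Set (H →L[ℂ] H)) := by
  rw [VonNeumannAlgebra.coe_toStarSubalgebra, ← M.centralizer_centralizer]
  exact Set.isClosed_centralizer _

end General

/-! ### The crossed product of `B ⊆ B(K)` by a group, acting on `ℓ²(Γ, K)` -/

section CrossedProduct

variable {K : Type*} [NormedAddCommGroup K] [InnerProductSpace ℂ K]
variable {Γ : Type*}

/-- The Hilbert space `ℓ²(Γ, K)`. -/
abbrev L2 (Γ K : Type*) [NormedAddCommGroup K] : Type _ := lp (fun _ : Γ => K) 2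

theorem memℓp_aux (r : Γ → Γ) (hr : Function.Injective r) (T : Γ → K →L[ℂ] K) (C : ℝ)
    (hT : ∀ g, ‖T g‖ ≤ C) (ξ : L2 Γ K) : Memℓp (fun g => T g (ξ (r g))) 2 := by
  have h2 : 0 < (2 : ℝ≥0∞).toReal := by norm_num
  have hs : Summable fun g => ‖ξ (r g)‖ ^ (2 : ℝ≥0∞).toReal :=
    ((lp.memℓp ξ).summable h2).comp_injective hr
  refine memℓp_gen ?_
  refine Summable.of_nonneg_of_le (fun g => by positivity) (fun g => ?_)
    (hs.mul_left (C ^ (2 : ℝ≥0∞).toReal))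
  have hC : 0 ≤ C := (norm_nonneg _).trans (hT g)
  rw [← Real.mul_rpow hC (norm_nonneg _)]
  refine Real.rpow_le_rpow (norm_nonneg _) ?_ h2.le
  exact (T g).le_of_opNorm_le (hT g) _

/-- The operator `(Φ ξ)(g) = T_g (ξ (r g))` on `ℓ²(Γ, K)`, for an injective map `r` and a
bounded family of operators `T_g`. -/
def lpOp (r : Γ → Γ) (hr : Function.Injective r) (T : Γ → K →L[ℂ] K) (C : ℝ)
    (hT : ∀ g, ‖T g‖ ≤ C) : L2 Γ K →L[ℂ] L2 Γ K :=
  LinearMap.mkContinuous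
    { toFun := fun ξ => ⟨fun g => T g (ξ (r g)), memℓp_aux r hr T C hT ξ⟩
      map_add' := fun ξ η => by
        ext g
        exact map_add (T g) _ _
      map_smul' := fun c ξ => by
        ext g
        exact map_smul (T g) c _ } (max C 0) (fun ξ => by
    have h2 : 0 < (2 : ℝ≥0∞).toReal := by norm_num
    have hC : (0 : ℝ) ≤ max C 0 := le_max_right _ _
    refine lp.norm_le_of_forall_sum_le h2 (by positivity) (fun s => ?_)
    classical
    calc ∑ g ∈ s, ‖T g (ξ (r g))‖ ^ (2 : ℝ≥0∞).toReal
        ≤ ∑ g ∈ s, (max C 0) ^ (2 : ℝ≥0∞).toReal * ‖ξ (r g)‖ ^ (2 : ℝ≥0∞).toReal := by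
          refine Finset.sum_le_sum fun g _ => ?_
          rw [← Real.mul_rpow hC (norm_nonneg _)]
          refine Real.rpow_le_rpow (norm_nonneg _) ?_ h2.le
          exact (T g).le_of_opNorm_le ((hT g).trans (le_max_left _ _)) _
      _ = (max C 0) ^ (2 : ℝ≥0∞).toReal *
            ∑ g ∈ s.image r, ‖ξ g‖ ^ (2 : ℝ≥0∞).toReal := by
          rw [← Finset.mul_sum, Finset.sum_image (fun a _ b _ h => hr h)]
      _ ≤ (max C 0) ^ (2 : ℝ≥0∞).toReal * ‖ξ‖ ^ (2 : ℝ≥0∞).toReal := by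
          gcongr
          exact lp.sum_rpow_le_norm_rpow h2 ξ _
      _ = (max C 0 * ‖ξ‖) ^ (2 : ℝ≥0∞).toReal := by
          rw [Real.mul_rpow hC (norm_nonneg _)])

@[simp]
theorem lpOp_apply (r : Γ → Γ) (hr : Function.Injective r) (T : Γ → K →L[ℂ] K) (C : ℝ)
    (hT : ∀ g, ‖T g‖ ≤ C) (ξ : L2 Γ K) (g : Γ) : lpOp r hr T C hT ξ g = T g (ξ (r g)) := rfl

variable [Group Γ]

/-- `(λ(h) ξ)(g) = ξ(h⁻¹ g)` on `ℓ²(Γ, K)`. -/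
def lam (K : Type*) [NormedAddCommGroup K] [InnerProductSpace ℂ K] (h : Γ) :
    L2 Γ K →L[ℂ] L2 Γ K :=
  lpOp (fun g => h⁻¹ * g) (mul_right_injective _) (fun _ => ContinuousLinearMap.id ℂ K) 1
    (fun _ => ContinuousLinearMap.norm_id_le)

variable [CompleteSpace K]

theorem norm_aut_le (B : VonNeumannAlgebra K) (β : B.toStarSubalgebra ≃⋆ₐ[ℂ] B.toStarSubalgebra)
    (b : B.toStarSubalgebra) : ‖((β b : B.toStarSubalgebra) : K →L[ℂ] K)‖ ≤ ‖(b : K →L[ℂ] K)‖ := by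
  have : IsClosed (B.toStarSubalgebra : Set (K →L[ℂ] K)) := isClosed_coe B
  exact (NonUnitalStarAlgHom.norm_apply_le β b :)

/-- `(π(b) ξ)(g) = α_{g⁻¹}(b) ξ(g)` on `ℓ²(Γ, K)`. -/
def piRep {B : VonNeumannAlgebra K}
    (α : Γ →* (B.toStarSubalgebra ≃⋆ₐ[ℂ] B.toStarSubalgebra)) (b : B.toStarSubalgebra) :
    L2 Γ K →L[ℂ] L2 Γ K :=
  lpOp id Function.injective_id (fun g => ((α g⁻¹ b : B.toStarSubalgebra) : K →L[ℂ] K))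
    ‖(b : K →L[ℂ] K)‖ (fun g => norm_aut_le B (α g⁻¹) b)

/-- The crossed product `B ⋊_α Γ`: the von Neumann algebra on `ℓ²(Γ, K)` generated by
`π(B)` and `λ(Γ)`. -/
def crossedProduct {B : VonNeumannAlgebra K}
    (α : Γ →* (B.toStarSubalgebra ≃⋆ₐ[ℂ] B.toStarSubalgebra)) : VonNeumannAlgebra (L2 Γ K) :=
  generatedBy (Set.range (piRep α) ∪ Set.range (lam (Γ := Γ) K))

/-- `L(Γ)`, as the von Neumann algebra on `ℓ²(Γ, K)` generated by the unitaries `λ(h)`. -/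
def groupVN (Γ : Type*) [Group Γ] (K : Type*) [NormedAddCommGroup K] [InnerProductSpace ℂ K]
    [CompleteSpace K] : VonNeumannAlgebra (L2 Γ K) :=
  generatedBy (Set.range (lam (Γ := Γ) K))

open scoped Classical in
/-- The compression of an operator on `ℓ²(Γ, K)` to the summand `δ₁ ⊗ K`. -/
def compress (x : L2 Γ K →L[ℂ] L2 Γ K) : K →L[ℂ] K :=
  (lp.evalCLM ℂ (fun _ : Γ => K) 2 1).comp
    (x.comp (lp.singleContinuousLinearMap ℂ (fun _ : Γ => K) 2 1))

/-- The compression of an element of the crossed product belongs to `B`. -/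
theorem compress_mem {B : VonNeumannAlgebra K}
    (α : Γ →* (B.toStarSubalgebra ≃⋆ₐ[ℂ] B.toStarSubalgebra))
    {x : L2 Γ K →L[ℂ] L2 Γ K} (hx : x ∈ (crossedProduct α).toStarSubalgebra) :
    compress x ∈ B.toStarSubalgebra := by
  classical
  rw [VonNeumannAlgebra.mem_carrier, ← B.centralizer_centralizer]
  intro c hc
  let d : L2 Γ K →L[ℂ] L2 Γ K := lpOp id Function.injective_id (fun _ => c) ‖c‖ (fun _ => le_rfl)
  have key : ∀ c' : K →L[ℂ] K, c' ∈ Set.centralizer (B : Set (K →L[ℂ] K)) →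
      ∀ s ∈ Set.range (piRep α) ∪ Set.range (lam (Γ := Γ) K),
        s * lpOp id Function.injective_id (fun _ => c') ‖c'‖ (fun _ => le_rfl) =
          lpOp id Function.injective_id (fun _ => c') ‖c'‖ (fun _ => le_rfl) * s := by
    rintro c' hc' s (⟨b, rfl⟩ | ⟨h, rfl⟩)
    · ext ξ g
      exact DFunLike.congr_fun (hc' _ (α g⁻¹ b).2) (ξ g)
    · refine ContinuousLinearMap.ext fun ξ => lp.ext (funext fun g => ?_)
      change lam K h _ g = _
      rw [lam, lpOp_apply]
      rfl
  have hstar : star d = lpOp id Function.injective_id (fun _ => star c) ‖star c‖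
      (fun _ => le_rfl) := by
    rw [ContinuousLinearMap.star_eq_adjoint, eq_comm, ContinuousLinearMap.eq_adjoint_iff]
    intro ξ η
    rw [lp.inner_eq_tsum, lp.inner_eq_tsum]
    refine tsum_congr fun g => ?_
    exact ContinuousLinearMap.adjoint_inner_left c (η g) (ξ g)
  have hc' : star c ∈ Set.centralizer (B : Set (K →L[ℂ] K)) := by
    intro b hb
    have := hc (star b) (star_mem hb)
    simpa using (congrArg star this).symm
  have hd : d ∈ (StarSubalgebra.centralizer ℂ
      (Set.range (piRep α) ∪ Set.range (lam (Γ := Γ) K)) : Set _) := by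
    refine (StarSubalgebra.mem_centralizer_iff ℂ).2 fun s hs => ⟨key c hc s hs, ?_⟩
    have h1 := key (star c) hc' s hs
    rw [← hstar] at h1
    simpa using (congrArg star h1).symm
  have hcomm : d * x = x * d := ((StarSubalgebra.mem_centralizer_iff ℂ).1 hx d hd).1
  ext k
  have h1 : d (lp.single 2 (1 : Γ) k) = lp.single 2 (1 : Γ) (c k) := by
    ext g
    by_cases hg : g = 1
    · subst hg
      simp [d]
    · simp [d, hg]
  have h2 := congrArg (fun ζ : L2 Γ K => ζ 1)
    (DFunLike.congr_fun hcomm (lp.single 2 (1 : Γ) k))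
  change c (x (lp.single 2 (1 : Γ) k) 1) = x (d (lp.single 2 (1 : Γ) k)) 1 at h2
  rw [h1] at h2
  exact h2

/-- The trace on the crossed product: `τ` of the coefficient at the neutral element, so that
`∑ π(x(γ)) λ(γ) ↦ τ(x(1))`. -/
def crossedTrace {B : VonNeumannAlgebra K}
    (α : Γ →* (B.toStarSubalgebra ≃⋆ₐ[ℂ] B.toStarSubalgebra))
    (τ : B.toStarSubalgebra →ₗ[ℂ] ℂ) : (crossedProduct α).toStarSubalgebra →ₗ[ℂ] ℂ where
  toFun x := τ ⟨compress (x : L2 Γ K →L[ℂ] L2 Γ K), compress_mem α x.2⟩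
  map_add' x y := by
    rw [← map_add]
    congr 1
  map_smul' c x := by
    rw [RingHom.id_apply, ← map_smul]
    congr 1

/-- A `τ`-preserving action `α` on `B` is strongly mixing if for every finite `F ⊆ B` and `ε > 0`
there is a finite `E ⊆ Γ` with `|τ(α_g(a) b) - τ(a) τ(b)| < ε` for all `a, b ∈ F`, `g ∉ E`. -/
def StronglyMixingAction {B : VonNeumannAlgebra K}
    (α : Γ →* (B.toStarSubalgebra ≃⋆ₐ[ℂ] B.toStarSubalgebra))
    (τ : B.toStarSubalgebra →ₗ[ℂ] ℂ) : Prop :=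
  ∀ F : Finset B.toStarSubalgebra, ∀ ε : ℝ, 0 < ε → ∃ E : Finset Γ,
    ∀ a ∈ F, ∀ b ∈ F, ∀ g : Γ, g ∉ E → ‖τ (α g a * b) - τ a * τ b‖ < ε

end CrossedProduct

end

end CrossedMixing

/-! Everything rests on one Parseval computation. For a unitary `u` of `A = L(Γ)` with `u* = ∑ c_g
λ(g)`, the operator `E(π(a) u* π(b))` has Fourier coefficients `c_g τ(α_{g⁻¹}(a) b)`: compressing by
`a` and `b` acts on `A` as a Fourier multiplier. Since `E(π(a)) = τ(a)` and `u` can be pulled out of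
`E`, this gives `‖E(u π(a) u* π(b)) - E(π(a)) E(π(b))‖₂² = ∑ |c_g|² |τ(α_{g⁻¹}(a) b) - τ(a) τ(b)|²`
(`hasSum_defect_piM`).

The numbers `|c_g|²` are a probability distribution on `Γ`. As `u → ∞` in an almost orthonormal
group, each `|c_g| = |τ(u λ(g))|` tends to `0`, so the mass leaves every finite set, while mixing of
the action says that the averaged function vanishes at infinity. Hence the averages tend to `0`
(`tendsto_weighted_sum_zero`, `mixesPair_piM`). The passage from `π(B)` to all of `M` uses that the
difference is `A`-linear in each variable and `‖·‖₂`-bounded in each variable uniformly in `u`, and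
that the span of the `λ(g) π(b)` is `‖·‖₂`-dense.

Conversely, `λ(Γ)` is itself almost orthonormal when `Γ` is infinite, because Fourier coefficients
are square summable, and for `u = λ(g)` the trace of the difference is exactly the correlation
`τ(α_g(a) b) - τ(a) τ(b)` (`norm_correlation_le`).

Three foundations are needed: a density theorem of double commutant type
(`IsStable.amp_mem_closure`), which reduces identities between normal functionals to monomials; the
fact that the canonical functional on `M` is a trace (`crossedTrace_isTrace`); and the existence of
`E`, realised as convolution by the Fourier coefficients (`isCondExp_condExp`). -/

namespace CrossedMixing

open Filter Topology
open scoped ENNReal ComplexOrder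

noncomputable section

/-! ### The 2-norm of a trace and algebraic properties of conditional expectations. -/

section Trace

variable {H : Type*} [NormedAddCommGroup H] [InnerProductSpace ℂ H] [CompleteSpace H]
variable {M : VonNeumannAlgebra H} {τ : M.toStarSubalgebra →ₗ[ℂ] ℂ}

/-- Polarisation: `τ` is real on `z* z` for `z = 1 + x` and `z = 1 + i x`, which fixes the imaginary
and the real part of `τ(x*)` respectively. -/
theorem map_star_of_nonneg (h0 : ∀ x, 0 ≤ τ (star x * x)) (x : M.toStarSubalgebra) :
    τ (star x) = starRingEnd ℂ (τ x) := by
  have e : ∀ c : ℂ, star (1 + c • x) * (1 + c • x) =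
      star (1 : M.toStarSubalgebra) * 1 + c • x + (starRingEnd ℂ c) • star x +
        (starRingEnd ℂ c * c) • (star x * x) := by
    intro c
    simp only [star_add, star_one, star_smul, add_mul, mul_add, one_mul, mul_one, smul_mul_assoc,
      mul_smul_comm, mul_smul, smul_add, RCLike.star_def, smul_comm c (starRingEnd ℂ c)]
    abel
  have him : ∀ z : M.toStarSubalgebra, (τ (star z * z)).im = 0 := fun z =>
    ((Complex.nonneg_iff.1 (h0 z)).2).symm
  have h1 := him (1 + (1 : ℂ) • x)
  have h2 := him (1 + Complex.I • x)
  rw [e, map_add, map_add, map_add, map_smul, map_smul, map_smul] at h1 h2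
  simp only [Complex.add_im, him, smul_eq_mul, Complex.mul_im, Complex.mul_re, map_one,
    Complex.conj_I, Complex.I_re, Complex.I_im, Complex.neg_re, Complex.neg_im, Complex.one_re,
    Complex.one_im] at h1 h2
  apply Complex.ext
  · simp only [Complex.conj_re]; linarith
  · simp only [Complex.conj_im]; linarith

/-- The pre-inner product `⟪x, y⟫ = τ(x* y)` of a positive functional. -/
abbrev traceCore (h0 : ∀ x, 0 ≤ τ (star x * x)) :
    PreInnerProductSpace.Core ℂ M.toStarSubalgebra where
  inner x y := τ (star x * y)
  conj_inner_symm x y := by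
    rw [← map_star_of_nonneg h0, star_mul, star_star]
  re_inner_nonneg x := (Complex.nonneg_iff.1 (h0 x)).1
  add_left x y z := by rw [star_add, add_mul, map_add]
  smul_left x y r := by rw [star_smul, smul_mul_assoc, map_smul]; rfl

theorem norm_map_star_mul_le (h0 : ∀ x, 0 ≤ τ (star x * x)) (x y : M.toStarSubalgebra) :
    ‖τ (star x * y)‖ ≤ norm₂ τ x * norm₂ τ y :=
  letI := traceCore h0
  @InnerProductSpace.Core.norm_inner_le_norm ℂ M.toStarSubalgebra _ _ _ (traceCore h0) x y

theorem norm₂_add_le (h0 : ∀ x, 0 ≤ τ (star x * x)) (x y : M.toStarSubalgebra) :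
    norm₂ τ (x + y) ≤ norm₂ τ x + norm₂ τ y :=
  @norm_add_le M.toStarSubalgebra
    (@InnerProductSpace.Core.toSeminormedAddCommGroup ℂ M.toStarSubalgebra _ _ _
      (traceCore h0)).toSeminormedAddGroup x y

theorem norm₂_nonneg (x : M.toStarSubalgebra) : 0 ≤ norm₂ τ x := Real.sqrt_nonneg _

@[simp]
theorem norm₂_zero : norm₂ τ (0 : M.toStarSubalgebra) = 0 := by simp [norm₂]

theorem norm₂_sq (h0 : ∀ x, 0 ≤ τ (star x * x)) (x : M.toStarSubalgebra) :
    norm₂ τ x ^ 2 = (τ (star x * x)).re :=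
  Real.sq_sqrt (Complex.nonneg_iff.1 (h0 x)).1

/-- Positivity of `τ` is only available on elements `z* z`, so the operator inequality `x* x ≤ ‖x‖²`
is put into that form. -/
theorem exists_star_mul_add_star_mul {A : Type*} [CStarAlgebra A] (x : A) :
    ∃ z : A, star x * x + star z * z = ((‖x‖ ^ 2 : ℝ) : ℂ) • (1 : A) := by
  let _ : PartialOrder A := CStarAlgebra.spectralOrder _
  have _ : StarOrderedRing A := CStarAlgebra.spectralOrderedRing _
  have h1 : star x * x ≤ algebraMap ℝ A (‖x‖ ^ 2) := CStarAlgebra.star_mul_le_algebraMap_norm_sq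
  obtain ⟨z, hz⟩ := CStarAlgebra.nonneg_iff_eq_star_mul_self.1 (sub_nonneg.2 h1)
  refine ⟨z, ?_⟩
  rw [← hz, add_sub_cancel, Algebra.algebraMap_eq_smul_one, Complex.coe_smul]

theorem norm₂_mul_le_norm_mul (h0 : ∀ x, 0 ≤ τ (star x * x)) (x y : M.toStarSubalgebra) :
    norm₂ τ (x * y) ≤ ‖x‖ * norm₂ τ y := by
  have hcl : IsClosed (M.toStarSubalgebra : Set (H →L[ℂ] H)) := isClosed_coe M
  let _ : CStarAlgebra M.toStarSubalgebra := StarSubalgebra.cstarAlgebra _ (h_closed := hcl)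
  obtain ⟨z, hz⟩ := exists_star_mul_add_star_mul x
  have e : star (x * y) * (x * y) + star (z * y) * (z * y) =
      ((‖x‖ ^ 2 : ℝ) : ℂ) • (star y * y) := by
    have : star (x * y) * (x * y) + star (z * y) * (z * y) =
        star y * (star x * x + star z * z) * y := by
      simp only [star_mul]; noncomm_ring
    rw [this, hz, mul_smul_comm, mul_one, smul_mul_assoc]
  have h2 := congrArg (fun w => (τ w).re) e
  simp only [map_add, Complex.add_re, map_smul, smul_eq_mul, Complex.re_ofReal_mul] at h2
  rw [← norm₂_sq h0, ← norm₂_sq h0, ← norm₂_sq h0] at h2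
  refine abs_le_of_sq_le_sq' ?_ (mul_nonneg (norm_nonneg _) (norm₂_nonneg _)) |>.2
  nlinarith [sq_nonneg (norm₂ τ (z * y))]

namespace IsTrace

theorem norm₂_star (hτ : IsTrace M τ) (x : M.toStarSubalgebra) :
    norm₂ τ (star x) = norm₂ τ x := by
  rw [norm₂, norm₂, star_star, hτ.tracial]

theorem norm₂_mul_le_mul_norm (hτ : IsTrace M τ) (x y : M.toStarSubalgebra) :
    norm₂ τ (x * y) ≤ norm₂ τ x * ‖y‖ := by
  rw [← hτ.norm₂_star, star_mul, mul_comm, ← hτ.norm₂_star x]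
  refine (norm₂_mul_le_norm_mul hτ.nonneg _ _).trans_eq ?_
  congr 1
  exact norm_star (y : H →L[ℂ] H)

theorem norm_map_le (hτ : IsTrace M τ) (x : M.toStarSubalgebra) : ‖τ x‖ ≤ norm₂ τ x := by
  have h := norm_map_star_mul_le hτ.nonneg 1 x
  rwa [star_one, one_mul, norm₂, star_one, one_mul, hτ.normalised, Complex.one_re, Real.sqrt_one,
    one_mul] at h

theorem norm₂_neg (x : M.toStarSubalgebra) : norm₂ τ (-x) = norm₂ τ x := by
  simp [norm₂]

theorem norm₂_sub_le (hτ : IsTrace M τ) (x y : M.toStarSubalgebra) :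
    norm₂ τ (x - y) ≤ norm₂ τ x + norm₂ τ y := by
  rw [sub_eq_add_neg, ← norm₂_neg y]
  exact norm₂_add_le hτ.nonneg _ _

theorem norm₂_mul_of_star_mul_self {u : M.toStarSubalgebra} (hu : star u * u = 1)
    (x : M.toStarSubalgebra) : norm₂ τ (u * x) = norm₂ τ x := by
  rw [norm₂, norm₂, star_mul, mul_assoc, ← mul_assoc (star u), hu, one_mul]

theorem norm₂_mul_of_mul_star_self (hτ : IsTrace M τ) {u : M.toStarSubalgebra}
    (hu : u * star u = 1) (x : M.toStarSubalgebra) : norm₂ τ (x * u) = norm₂ τ x := by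
  rw [← hτ.norm₂_star, star_mul, norm₂_mul_of_star_mul_self (by rwa [star_star]), hτ.norm₂_star]

end IsTrace

namespace IsCondExp

variable {A : VonNeumannAlgebra H} {E : M.toStarSubalgebra → M.toStarSubalgebra}

/-- Testing with `a = (E x - d)*`, which lies in `A`, gives `‖E x - d‖₂ = 0`. The linearity and
`A`-bimodule properties of `E` all come from this uniqueness. -/
theorem eq_of_forall (hE : IsCondExp τ A E) (hτ : IsTrace M τ) {x d : M.toStarSubalgebra}
    (hd : (d : H →L[ℂ] H) ∈ A)
    (h : ∀ a : M.toStarSubalgebra, (a : H →L[ℂ] H) ∈ A → τ (d * a) = τ (x * a)) : E x = d := by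
  have hmem : ((star (E x - d) : M.toStarSubalgebra) : H →L[ℂ] H) ∈ A :=
    star_mem (sub_mem (hE.1 x) hd)
  refine sub_eq_zero.1 (hτ.faithful _ ?_)
  rw [hτ.tracial, sub_mul, map_sub, hE.2 _ _ hmem, h _ hmem, sub_self]

theorem map_add (hE : IsCondExp τ A E) (hτ : IsTrace M τ) (x y : M.toStarSubalgebra) :
    E (x + y) = E x + E y :=
  hE.eq_of_forall hτ (add_mem (hE.1 x) (hE.1 y)) fun a ha => by
    rw [add_mul, add_mul, _root_.map_add, _root_.map_add, hE.2 _ _ ha, hE.2 _ _ ha]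

theorem map_zero (hE : IsCondExp τ A E) (hτ : IsTrace M τ) : E 0 = 0 :=
  hE.eq_of_forall hτ (zero_mem A) fun _ _ => rfl

theorem map_neg (hE : IsCondExp τ A E) (hτ : IsTrace M τ) (x : M.toStarSubalgebra) :
    E (-x) = -E x :=
  hE.eq_of_forall hτ (neg_mem (hE.1 x)) fun a ha => by
    rw [neg_mul, neg_mul, _root_.map_neg, _root_.map_neg, hE.2 _ _ ha]

theorem map_sub (hE : IsCondExp τ A E) (hτ : IsTrace M τ) (x y : M.toStarSubalgebra) :
    E (x - y) = E x - E y := by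
  rw [sub_eq_add_neg, hE.map_add hτ, hE.map_neg hτ, sub_eq_add_neg]

theorem map_mul_left (hE : IsCondExp τ A E) (hτ : IsTrace M τ) {a : M.toStarSubalgebra}
    (ha : (a : H →L[ℂ] H) ∈ A) (x : M.toStarSubalgebra) : E (a * x) = a * E x :=
  hE.eq_of_forall hτ (mul_mem ha (hE.1 x)) fun b hb => by
    rw [mul_assoc, hτ.tracial, mul_assoc, hE.2 _ _ (mul_mem hb ha), ← mul_assoc, hτ.tracial,
      ← mul_assoc]

theorem map_mul_right (hE : IsCondExp τ A E) (hτ : IsTrace M τ) {a : M.toStarSubalgebra}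
    (ha : (a : H →L[ℂ] H) ∈ A) (x : M.toStarSubalgebra) : E (x * a) = E x * a :=
  hE.eq_of_forall hτ (mul_mem (hE.1 x) ha) fun b hb => by
    rw [mul_assoc, hE.2 _ _ (mul_mem ha hb), mul_assoc]

theorem norm₂_le (hE : IsCondExp τ A E) (hτ : IsTrace M τ) (x : M.toStarSubalgebra) :
    norm₂ τ (E x) ≤ norm₂ τ x := by
  have h1 : norm₂ τ (E x) ^ 2 ≤ norm₂ τ (E x) * norm₂ τ x := by
    have h2 : τ (star (E x) * E x) = τ (star (E x) * x) := by
      rw [hτ.tracial, hE.2 _ _ (star_mem (hE.1 x)), hτ.tracial]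
    rw [norm₂_sq hτ.nonneg, h2]
    exact (Complex.re_le_norm _).trans (norm_map_star_mul_le hτ.nonneg _ _)
  by_contra! h
  nlinarith [norm₂_nonneg (τ := τ) x, norm₂_nonneg (τ := τ) (E x)]

end IsCondExp

end Trace

/-! ### Ultraweakly continuous functionals and density. -/

section Ultraweak

variable {H : Type*} [NormedAddCommGroup H] [InnerProductSpace ℂ H]
variable {ι : Type*}

/-- The diagonal operator `1 ⊗ x` on `ℓ²(ι, H)`. -/
def amp (ι : Type*) (x : H →L[ℂ] H) : L2 ι H →L[ℂ] L2 ι H :=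
  lpOp id Function.injective_id (fun _ => x) ‖x‖ (fun _ => le_rfl)

@[simp]
theorem amp_apply (x : H →L[ℂ] H) (ξ : L2 ι H) (i : ι) : amp ι x ξ i = x (ξ i) := rfl

theorem amp_mul_apply (x y : H →L[ℂ] H) (ξ : L2 ι H) : amp ι (x * y) ξ = amp ι x (amp ι y ξ) := rfl

/-- The linear map `x ↦ (1 ⊗ x) ξ`. -/
def ampLin (ξ : L2 ι H) : (H →L[ℂ] H) →ₗ[ℂ] L2 ι H where
  toFun x := amp ι x ξ
  map_add' _ _ := rfl
  map_smul' _ _ := rfl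

/-- A square summable family as an element of `ℓ²`. -/
def toL2 (ξ : ι → H) (h : Summable fun i => ‖ξ i‖ ^ 2) : L2 ι H :=
  ⟨ξ, memℓp_gen (by simpa using h)⟩

theorem hasSum_norm_sq (ξ : L2 ι H) : HasSum (fun i => ‖ξ i‖ ^ 2) (‖ξ‖ ^ 2) := by
  simpa using lp.hasSum_norm (p := 2) (by norm_num) ξ

/-- The pair of two elements of `ℓ²`. -/
def sumL2 {ι' : Type*} (ξ : L2 ι H) (ξ' : L2 ι' H) : L2 (ι ⊕ ι') H :=
  toL2 (Sum.elim ξ ξ')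
    (HasSum.sum (f := fun i => ‖Sum.elim ξ ξ' i‖ ^ 2) (hasSum_norm_sq ξ) (hasSum_norm_sq ξ')).summable

theorem inner_sumL2 {ι' : Type*} (ξ η : L2 ι H) (ξ' η' : L2 ι' H) :
    inner ℂ (sumL2 ξ ξ') (sumL2 η η') = inner ℂ ξ η + inner ℂ ξ' η' :=
  (lp.hasSum_inner (𝕜 := ℂ) (sumL2 ξ ξ') (sumL2 η η')).unique
    (HasSum.sum (f := fun i => inner ℂ (sumL2 ξ ξ' i) (sumL2 η η' i))
      (lp.hasSum_inner (𝕜 := ℂ) ξ η) (lp.hasSum_inner (𝕜 := ℂ) ξ' η'))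

theorem amp_sumL2 {ι' : Type*} (x : H →L[ℂ] H) (ξ : L2 ι H) (ξ' : L2 ι' H) :
    amp (ι ⊕ ι') x (sumL2 ξ ξ') = sumL2 (amp ι x ξ) (amp ι' x ξ') := by
  ext i
  cases i <;> rfl

theorem norm_sumL2_sq {ι' : Type*} (ξ : L2 ι H) (ξ' : L2 ι' H) :
    ‖sumL2 ξ ξ'‖ ^ 2 = ‖ξ‖ ^ 2 + ‖ξ'‖ ^ 2 :=
  (hasSum_norm_sq (sumL2 ξ ξ')).unique (HasSum.sum (f := fun i => ‖sumL2 ξ ξ' i‖ ^ 2)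
    (hasSum_norm_sq ξ) (hasSum_norm_sq ξ'))

open scoped Classical in
theorem ext_single {F : Type*} [NormedAddCommGroup F] [NormedSpace ℂ F] {S T : L2 ι H →L[ℂ] F}
    (h : ∀ i v, S (lp.single 2 i v) = T (lp.single 2 i v)) : S = T := by
  ext ξ
  have hs := lp.hasSum_single (p := 2) (by norm_num) ξ
  refine (hs.mapL S).unique ?_
  simp only [h]
  exact hs.mapL T

variable [CompleteSpace H]

theorem inner_amp_left (x : H →L[ℂ] H) (ξ η : L2 ι H) :
    inner ℂ (amp ι x η) ξ = inner ℂ η (amp ι (star x) ξ) := by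
  rw [lp.inner_eq_tsum, lp.inner_eq_tsum]
  exact tsum_congr fun i => (ContinuousLinearMap.adjoint_inner_right x (η i) (ξ i)).symm

theorem commute_starProjection {L : Submodule ℂ H} [L.HasOrthogonalProjection] {T : H →L[ℂ] H}
    (h : ∀ v ∈ L, T v ∈ L) (h' : ∀ v ∈ L, star T v ∈ L) (v : H) :
    L.starProjection (T v) = T (L.starProjection v) := by
  refine Submodule.eq_starProjection_of_mem_orthogonal (h _ (Submodule.starProjection_apply_mem _ _)) ?_
  rw [← map_sub, Submodule.mem_orthogonal]
  intro u hu
  rw [← ContinuousLinearMap.adjoint_inner_left]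
  exact Submodule.inner_right_of_mem_orthogonal (h' u hu)
    (Submodule.sub_starProjection_mem_orthogonal v)

theorem mem_generatedBy_iff {S : Set (H →L[ℂ] H)} {x : H →L[ℂ] H} :
    x ∈ generatedBy S ↔ ∀ c : H →L[ℂ] H, (∀ s ∈ S, s * c = c * s ∧ star s * c = c * star s) →
      c * x = x * c := by
  change x ∈ (StarSubalgebra.centralizer ℂ (StarSubalgebra.centralizer ℂ S : Set (H →L[ℂ] H))) ↔ _
  rw [StarSubalgebra.mem_centralizer_iff]
  refine ⟨fun h c hc => (h c ((StarSubalgebra.mem_centralizer_iff ℂ).2 hc)).1, fun h c hc => ?_⟩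
  exact ⟨h c ((StarSubalgebra.mem_centralizer_iff ℂ).1 hc),
    h _ ((StarSubalgebra.mem_centralizer_iff ℂ).1 (star_mem hc))⟩

theorem subset_generatedBy (S : Set (H →L[ℂ] H)) {s : H →L[ℂ] H} (hs : s ∈ S) :
    s ∈ generatedBy S :=
  mem_generatedBy_iff.2 fun _ hc => (hc s hs).1.symm

theorem generatedBy_mono {S T : Set (H →L[ℂ] H)} (h : S ⊆ T) {x : H →L[ℂ] H}
    (hx : x ∈ generatedBy S) : x ∈ generatedBy T :=
  mem_generatedBy_iff.2 fun c hc => mem_generatedBy_iff.1 hx c fun s hs => hc s (h hs)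

/-- `X` contains `1` and is stable under left multiplication by `S ∪ S*`, so that its span is
ultraweakly dense in the von Neumann algebra generated by `S`. -/
structure IsStable (S X : Set (H →L[ℂ] H)) : Prop where
  one_mem : 1 ∈ X
  mul_mem : ∀ s ∈ S, ∀ v ∈ X, s * v ∈ X
  star_mul_mem : ∀ s ∈ S, ∀ v ∈ X, star s * v ∈ X

variable {S X : Set (H →L[ℂ] H)}

/-- Von Neumann's density argument. The closure `L` of `(1 ⊗ span X) ξ` reduces `1 ⊗ s` for `s ∈ S`,
so the matrix entries `p m n` of the projection onto `L` commute with `S ∪ S*`, hence with `x`. Thus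
`1 ⊗ x` commutes with the projection and preserves `L`, which contains `ξ` because `1 ∈ X`. -/
theorem IsStable.amp_mem_closure (hX : IsStable S X) {x : H →L[ℂ] H} (hx : x ∈ generatedBy S)
    (ξ : L2 ι H) : amp ι x ξ ∈ ((Submodule.span ℂ X).map (ampLin ξ)).topologicalClosure := by
  classical
  set L := ((Submodule.span ℂ X).map (ampLin ξ)).topologicalClosure with hL
  have hinv : ∀ t : H →L[ℂ] H, (∀ v ∈ X, t * v ∈ X) → ∀ ζ ∈ L, amp ι t ζ ∈ L := by
    intro t ht ζ hζ
    refine map_mem_closure (amp ι t).continuous hζ ?_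
    rintro _ ⟨v, hv, rfl⟩
    refine ⟨t * v, ?_, rfl⟩
    have : Submodule.span ℂ X ≤ (Submodule.span ℂ X).comap (LinearMap.mulLeft ℂ t) :=
      Submodule.span_le.2 fun w hw => Submodule.subset_span (ht w hw)
    exact this hv
  have hstar : ∀ t : H →L[ℂ] H, star (amp ι t) = amp ι (star t) := by
    intro t
    rw [ContinuousLinearMap.star_eq_adjoint, eq_comm, ContinuousLinearMap.eq_adjoint_iff]
    intro ζ η
    rw [inner_amp_left, star_star]
  have hP : ∀ t : H →L[ℂ] H, (∀ v ∈ X, t * v ∈ X) → (∀ v ∈ X, star t * v ∈ X) → ∀ ζ,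
      L.starProjection (amp ι t ζ) = amp ι t (L.starProjection ζ) := fun t ht ht' =>
    commute_starProjection (hinv t ht) (by rw [hstar]; exact hinv _ ht')
  let p : ι → ι → H →L[ℂ] H := fun m n => (lp.evalCLM ℂ (fun _ : ι => H) 2 m).comp
    (L.starProjection.comp (lp.singleContinuousLinearMap ℂ (fun _ : ι => H) 2 n))
  have hamp : ∀ (t : H →L[ℂ] H) (n : ι) (v : H),
      amp ι t (lp.single 2 n v) = lp.single 2 n (t v) := by
    intro t n v
    ext i
    by_cases hi : i = n
    · subst hi; simp
    · simp [hi]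
  have hp : ∀ t : H →L[ℂ] H, (∀ v ∈ X, t * v ∈ X) → (∀ v ∈ X, star t * v ∈ X) → ∀ m n,
      t * p m n = p m n * t := by
    intro t ht ht' m n
    ext v
    have := congrArg (fun ζ : L2 ι H => ζ m) (hP t ht ht' (lp.single 2 n v))
    rw [hamp] at this
    exact this.symm
  have hx' : ∀ m n, p m n * x = x * p m n := fun m n => mem_generatedBy_iff.1 hx _ fun s hs =>
    ⟨hp s (hX.mul_mem s hs) (hX.star_mul_mem s hs) m n,
      hp (star s) (hX.star_mul_mem s hs) (by rw [star_star]; exact hX.mul_mem s hs) m n⟩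
  have hcomm : L.starProjection.comp (amp ι x) = (amp ι x).comp L.starProjection := by
    refine ext_single fun n v => ?_
    ext m
    have := DFunLike.congr_fun (hx' m n) v
    change L.starProjection (amp ι x (lp.single 2 n v)) m = _
    rw [hamp]
    exact this
  have hξ : ξ ∈ L := Submodule.le_topologicalClosure _
    ⟨1, Submodule.subset_span hX.one_mem, rfl⟩
  have h1 := DFunLike.congr_fun hcomm ξ
  change L.starProjection (amp ι x ξ) = amp ι x (L.starProjection ξ) at h1
  rw [Submodule.starProjection_eq_self_iff.2 hξ] at h1
  rw [← h1]
  exact Submodule.starProjection_apply_mem _ _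

/-- Functionals of the form `x ↦ ∑ ⟪ηᵢ, x ξᵢ⟫` with square summable `ξ`, `η`. -/
def IsUltraweak (φ : (H →L[ℂ] H) → ℂ) : Prop :=
  ∃ (ι : Type) (ξ η : L2 ι H), ∀ x, φ x = inner ℂ η (amp ι x ξ)

namespace IsUltraweak

variable {φ ψ : (H →L[ℂ] H) → ℂ}

theorem sub (hφ : IsUltraweak φ) (hψ : IsUltraweak ψ) : IsUltraweak fun x => φ x - ψ x := by
  obtain ⟨ι, ξ, η, h⟩ := hφ
  obtain ⟨ι', ξ', η', h'⟩ := hψ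
  refine ⟨ι ⊕ ι', sumL2 ξ (-ξ'), sumL2 η η', fun x => ?_⟩
  beta_reduce
  rw [amp_sumL2, inner_sumL2, h, h', map_neg, inner_neg_right, sub_eq_add_neg]

theorem const_mul (hφ : IsUltraweak φ) (c : ℂ) : IsUltraweak fun x => c * φ x := by
  obtain ⟨ι, ξ, η, h⟩ := hφ
  exact ⟨ι, c • ξ, η, fun x => by beta_reduce; rw [h, map_smul, inner_smul_right]⟩

theorem mul_left (hφ : IsUltraweak φ) (a : H →L[ℂ] H) : IsUltraweak fun x => φ (a * x) := by
  obtain ⟨ι, ξ, η, h⟩ := hφ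
  exact ⟨ι, ξ, amp ι (star a) η, fun x => by
    beta_reduce; rw [h, amp_mul_apply, inner_amp_left, star_star]⟩

theorem mul_right (hφ : IsUltraweak φ) (a : H →L[ℂ] H) : IsUltraweak fun x => φ (x * a) := by
  obtain ⟨ι, ξ, η, h⟩ := hφ
  exact ⟨ι, amp ι a ξ, η, fun x => by beta_reduce; rw [h, amp_mul_apply]⟩

/-- The kernel of `⟪η, ·⟫` is closed and contains `(1 ⊗ span X) ξ`, hence also `(1 ⊗ x) ξ` by
density. -/
theorem eq_zero_on (hφ : IsUltraweak φ) (hX : IsStable S X) (h0 : ∀ v ∈ X, φ v = 0)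
    {x : H →L[ℂ] H} (hx : x ∈ generatedBy S) : φ x = 0 := by
  obtain ⟨ι, ξ, η, h⟩ := hφ
  have hle : (Submodule.span ℂ X).map (ampLin ξ) ≤ (innerSL ℂ η).ker := by
    rw [Submodule.map_span_le]
    intro v hv
    rw [LinearMap.mem_ker, ← h0 v hv, h]
    rfl
  have := Submodule.topologicalClosure_minimal _ hle (ContinuousLinearMap.isClosed_ker _)
    (hX.amp_mem_closure hx ξ)
  rw [h]
  exact this

theorem eqOn (hφ : IsUltraweak φ) (hψ : IsUltraweak ψ) (hX : IsStable S X)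
    (h : ∀ v ∈ X, φ v = ψ v) {x : H →L[ℂ] H} (hx : x ∈ generatedBy S) : φ x = ψ x :=
  sub_eq_zero.1 ((hφ.sub hψ).eq_zero_on hX (fun v hv => sub_eq_zero.2 (h v hv)) hx)

end IsUltraweak

theorem IsNormalFunctional.exists_eq_inner {M : VonNeumannAlgebra H}
    {τ : M.toStarSubalgebra →ₗ[ℂ] ℂ} (hτ : IsNormalFunctional M τ) :
    ∃ ξ η : L2 ℕ H, ∀ x : M.toStarSubalgebra,
      τ x = inner ℂ η (amp ℕ (x : H →L[ℂ] H) ξ) := by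
  obtain ⟨ξ, η, hξ, hη, h⟩ := hτ
  refine ⟨toL2 ξ hξ, toL2 η hη, fun x => (h x).unique ?_⟩
  exact lp.hasSum_inner (𝕜 := ℂ) (toL2 η hη) (amp ℕ (x : H →L[ℂ] H) (toL2 ξ hξ))

theorem IsNormalFunctional.exists_isUltraweak {M : VonNeumannAlgebra H}
    {τ : M.toStarSubalgebra →ₗ[ℂ] ℂ} (hτ : IsNormalFunctional M τ) :
    ∃ φ : (H →L[ℂ] H) → ℂ, IsUltraweak φ ∧ ∀ x : M.toStarSubalgebra, φ (x : H →L[ℂ] H) = τ x := by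
  obtain ⟨ξ, η, h⟩ := hτ.exists_eq_inner
  exact ⟨fun x => inner ℂ η (amp ℕ x ξ), ⟨ℕ, ξ, η, fun x => rfl⟩, fun x => (h x).symm⟩

/-- With `τ = ⟪Η, (1 ⊗ ·) Ξ⟫`, Cauchy–Schwarz gives `‖y‖₂² ≤ ‖(1 ⊗ y) Η‖ ‖(1 ⊗ y) Ξ‖`. Applying
density to the single vector `Ξ ⊕ Η` makes both factors small with the same approximant. -/
theorem IsStable.exists_norm₂_sub_lt (hX : IsStable S X) {M : VonNeumannAlgebra H}
    {τ : M.toStarSubalgebra →ₗ[ℂ] ℂ} (hn : IsNormalFunctional M τ)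
    (hXM : ∀ v ∈ X, v ∈ M) (x : M.toStarSubalgebra)
    (hx : (x : H →L[ℂ] H) ∈ generatedBy S) {ε : ℝ} (hε : 0 < ε) :
    ∃ v ∈ Submodule.span ℂ {v : M.toStarSubalgebra | (v : H →L[ℂ] H) ∈ X},
      norm₂ τ (x - v) < ε := by
  obtain ⟨Ξ, Η, hτ⟩ := hn.exists_eq_inner
  obtain ⟨_, ⟨v, hv, rfl⟩, hlt⟩ := Metric.mem_closure_iff.1
    (hX.amp_mem_closure hx (sumL2 Ξ Η)) ε hε
  have hspan : ∀ w ∈ Submodule.span ℂ X, ∃ w' ∈ Submodule.span ℂ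
      {v : M.toStarSubalgebra | (v : H →L[ℂ] H) ∈ X}, (w' : H →L[ℂ] H) = w := by
    intro w hw
    have hle : Submodule.span ℂ X ≤ (Submodule.span ℂ
        {v : M.toStarSubalgebra | (v : H →L[ℂ] H) ∈ X}).map
          (M.toStarSubalgebra.subtype : M.toStarSubalgebra →ₗ[ℂ] (H →L[ℂ] H)) :=
      Submodule.span_le.2 fun w hw =>
        ⟨⟨w, hXM w hw⟩, Submodule.subset_span hw, rfl⟩
    exact hle hw
  obtain ⟨v, hv', rfl⟩ := hspan v hv
  refine ⟨v, hv', ?_⟩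
  rw [dist_eq_norm] at hlt
  have hlt' : ‖amp (ℕ ⊕ ℕ) ((x - v : M.toStarSubalgebra) : H →L[ℂ] H) (sumL2 Ξ Η)‖ < ε := hlt
  generalize x - v = y at hlt'
  have hsq := norm_sumL2_sq (amp ℕ (y : H →L[ℂ] H) Ξ) (amp ℕ (y : H →L[ℂ] H) Η)
  rw [← amp_sumL2] at hsq
  have hb : (τ (star y * y)).re ≤ ‖amp ℕ (y : H →L[ℂ] H) Η‖ * ‖amp ℕ (y : H →L[ℂ] H) Ξ‖ := by
    refine (Complex.re_le_norm _).trans ?_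
    have : τ (star y * y) = inner ℂ (amp ℕ (y : H →L[ℂ] H) Η) (amp ℕ (y : H →L[ℂ] H) Ξ) := by
      rw [hτ, inner_amp_left]
      rfl
    rw [this]
    exact norm_inner_le_norm _ _
  rw [norm₂, Real.sqrt_lt' hε]
  nlinarith [sq_nonneg (‖amp ℕ (y : H →L[ℂ] H) Η‖ - ‖amp ℕ (y : H →L[ℂ] H) Ξ‖),
    norm_nonneg (amp (ℕ ⊕ ℕ) (y : H →L[ℂ] H) (sumL2 Ξ Η)),
    sq_nonneg ‖amp ℕ (y : H →L[ℂ] H) Η‖, sq_nonneg ‖amp ℕ (y : H →L[ℂ] H) Ξ‖]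

end Ultraweak

/-! ### Monomials, Fourier coefficients and the trace of the crossed product. -/

section CrossedProduct

variable {K : Type*} [NormedAddCommGroup K] [InnerProductSpace ℂ K]
variable {Γ : Type*}

section Lam

variable [Group Γ]

@[simp]
theorem lam_apply (h : Γ) (ξ : L2 Γ K) (g : Γ) : lam K h ξ g = ξ (h⁻¹ * g) := rfl

theorem lam_one : lam K (1 : Γ) = 1 := by
  ext ξ g
  simp

theorem lam_mul_lam (g h : Γ) : lam K g * lam K h = lam K (g * h) := by
  ext ξ k
  change ξ (h⁻¹ * (g⁻¹ * k)) = ξ ((g * h)⁻¹ * k)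
  rw [mul_inv_rev, mul_assoc]

open scoped Classical in
theorem lam_single (g h : Γ) (v : K) : lam K g (lp.single 2 h v) = lp.single 2 (g * h) v := by
  ext k
  rw [lam_apply]
  by_cases hk : k = g * h
  · subst hk
    rw [inv_mul_cancel_left, lp.single_apply_self, lp.single_apply_self]
  · rw [lp.single_apply_ne _ _ _ hk, lp.single_apply_ne]
    rintro rfl
    exact hk (by group)

variable [CompleteSpace K]

theorem star_lam (g : Γ) : star (lam K g) = lam K g⁻¹ := by
  rw [ContinuousLinearMap.star_eq_adjoint, eq_comm, ContinuousLinearMap.eq_adjoint_iff]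
  intro ξ η
  rw [lp.inner_eq_tsum, lp.inner_eq_tsum, ← (Equiv.mulLeft g⁻¹).tsum_eq]
  refine tsum_congr fun k => ?_
  simp

theorem isStable_lam : IsStable (Set.range (lam (Γ := Γ) K)) (Set.range (lam (Γ := Γ) K)) where
  one_mem := ⟨1, lam_one⟩
  mul_mem := by
    rintro _ ⟨g, rfl⟩ _ ⟨h, rfl⟩
    exact ⟨g * h, (lam_mul_lam g h).symm⟩
  star_mul_mem := by
    rintro _ ⟨g, rfl⟩ _ ⟨h, rfl⟩
    exact ⟨g⁻¹ * h, by rw [star_lam, lam_mul_lam]⟩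

end Lam

variable [Group Γ] [CompleteSpace K] {B : VonNeumannAlgebra K}
  (α : Γ →* (B.toStarSubalgebra ≃⋆ₐ[ℂ] B.toStarSubalgebra))

@[simp]
theorem piRep_apply (b : B.toStarSubalgebra) (ξ : L2 Γ K) (g : Γ) :
    piRep α b ξ g = ((α g⁻¹ b : B.toStarSubalgebra) : K →L[ℂ] K) (ξ g) := rfl

theorem act_mul (g h : Γ) (b : B.toStarSubalgebra) : α (g * h) b = α g (α h b) := by
  rw [map_mul]; rfl

theorem act_one (b : B.toStarSubalgebra) : α 1 b = b := by
  rw [map_one]; rfl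

theorem piRep_one : piRep α 1 = 1 := by
  ext ξ g
  rw [piRep_apply, map_one]
  rfl

theorem piRep_mul (a b : B.toStarSubalgebra) : piRep α a * piRep α b = piRep α (a * b) := by
  ext ξ g
  rw [piRep_apply, map_mul]
  rfl

theorem star_piRep (b : B.toStarSubalgebra) : star (piRep α b) = piRep α (star b) := by
  rw [ContinuousLinearMap.star_eq_adjoint, eq_comm, ContinuousLinearMap.eq_adjoint_iff]
  intro ξ η
  rw [lp.inner_eq_tsum, lp.inner_eq_tsum]
  refine tsum_congr fun g => ?_
  rw [piRep_apply, map_star]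
  exact ContinuousLinearMap.adjoint_inner_left _ (η g) (ξ g)

theorem lam_mul_piRep (g : Γ) (b : B.toStarSubalgebra) :
    lam K g * piRep α b = piRep α (α g b) * lam K g := by
  ext ξ k
  change ((α (g⁻¹ * k)⁻¹ b : B.toStarSubalgebra) : K →L[ℂ] K) (ξ (g⁻¹ * k)) =
    ((α k⁻¹ (α g b) : B.toStarSubalgebra) : K →L[ℂ] K) (ξ (g⁻¹ * k))
  rw [← act_mul, mul_inv_rev, inv_inv]

theorem piRep_mul_lam (g : Γ) (b : B.toStarSubalgebra) :
    piRep α b * lam K g = lam K g * piRep α (α g⁻¹ b) := by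
  rw [lam_mul_piRep, ← act_mul, mul_inv_cancel, act_one]

/-- The operators `λ(g) π(b)`, whose linear combinations form the algebraic crossed product. -/
def monomials : Set (L2 Γ K →L[ℂ] L2 Γ K) :=
  Set.range fun p : Γ × B.toStarSubalgebra => lam K p.1 * piRep α p.2

theorem isStable_monomials :
    IsStable (Set.range (piRep α) ∪ Set.range (lam (Γ := Γ) K)) (monomials α) where
  one_mem := ⟨(1, 1), by beta_reduce; rw [lam_one, piRep_one, one_mul]⟩
  mul_mem := by
    rintro _ (⟨b, rfl⟩ | ⟨g, rfl⟩) _ ⟨⟨h, c⟩, rfl⟩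
    · exact ⟨(h, α h⁻¹ b * c), by rw [← mul_assoc, piRep_mul_lam, mul_assoc, piRep_mul]⟩
    · exact ⟨(g * h, c), by rw [← mul_assoc, lam_mul_lam]⟩
  star_mul_mem := by
    rintro _ (⟨b, rfl⟩ | ⟨g, rfl⟩) _ ⟨⟨h, c⟩, rfl⟩
    · exact ⟨(h, α h⁻¹ (star b) * c), by
        rw [star_piRep, ← mul_assoc, piRep_mul_lam, mul_assoc, piRep_mul]⟩
    · exact ⟨(g⁻¹ * h, c), by rw [star_lam, ← mul_assoc, lam_mul_lam]⟩

/-- `λ(g)` as an element of the crossed product. -/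
def lamM (g : Γ) : (crossedProduct α).toStarSubalgebra :=
  ⟨lam K g, subset_generatedBy _ (Or.inr ⟨g, rfl⟩)⟩

/-- `π(b)` as an element of the crossed product. -/
def piM (b : B.toStarSubalgebra) : (crossedProduct α).toStarSubalgebra :=
  ⟨piRep α b, subset_generatedBy _ (Or.inl ⟨b, rfl⟩)⟩

@[simp]
theorem coe_piM (b : B.toStarSubalgebra) : (piM α b : L2 Γ K →L[ℂ] L2 Γ K) = piRep α b := rfl

theorem lamM_one : lamM α 1 = 1 := Subtype.ext lam_one

theorem lamM_mul_lamM (g h : Γ) : lamM α g * lamM α h = lamM α (g * h) :=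
  Subtype.ext (lam_mul_lam g h)

theorem star_lamM (g : Γ) : star (lamM α g) = lamM α g⁻¹ := Subtype.ext (star_lam g)

theorem piM_one : piM α 1 = 1 := Subtype.ext (piRep_one α)

theorem piM_mul_piM (a b : B.toStarSubalgebra) : piM α a * piM α b = piM α (a * b) :=
  Subtype.ext (piRep_mul α a b)

theorem lamM_mul_piM (g : Γ) (b : B.toStarSubalgebra) :
    lamM α g * piM α b = piM α (α g b) * lamM α g := Subtype.ext (lam_mul_piRep α g b)

theorem piM_mul_lamM (g : Γ) (b : B.toStarSubalgebra) :
    piM α b * lamM α g = lamM α g * piM α (α g⁻¹ b) := Subtype.ext (piRep_mul_lam α g b)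

theorem mem_crossedProduct_of_mem_groupVN {x : L2 Γ K →L[ℂ] L2 Γ K} (hx : x ∈ groupVN Γ K) :
    x ∈ crossedProduct α :=
  generatedBy_mono Set.subset_union_right hx

theorem lamM_mem (g : Γ) : (lamM α g : L2 Γ K →L[ℂ] L2 Γ K) ∈ groupVN Γ K :=
  subset_generatedBy _ ⟨g, rfl⟩

/-- The coefficient `x(g)` in the expansion `x = ∑ λ(g) π(x(g))`. -/
def coef (x : (crossedProduct α).toStarSubalgebra) (g : Γ) : B.toStarSubalgebra :=
  ⟨compress ((lamM α g⁻¹ * x : (crossedProduct α).toStarSubalgebra) : L2 Γ K →L[ℂ] L2 Γ K),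
    compress_mem α (lamM α g⁻¹ * x).2⟩

open scoped Classical in
-- The coefficient at `g` is the matrix entry of `x` in row `g` and column `1`: left multiplication
-- by `λ(g⁻¹)` moves row `g` to row `1`.
theorem coef_apply (x : (crossedProduct α).toStarSubalgebra) (g : Γ) (k : K) :
    (coef α x g : K →L[ℂ] K) k = (x : L2 Γ K →L[ℂ] L2 Γ K) (lp.single 2 1 k) g := by
  change lam K g⁻¹ ((x : L2 Γ K →L[ℂ] L2 Γ K) (lp.single 2 1 k)) 1 = _
  rw [lam_apply, inv_inv, mul_one]

variable (τ : B.toStarSubalgebra →ₗ[ℂ] ℂ)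

theorem crossedTrace_lamM_mul (x : (crossedProduct α).toStarSubalgebra) (g : Γ) :
    crossedTrace α τ (lamM α g * x) = τ (coef α x g⁻¹) := by
  obtain ⟨h, rfl⟩ : ∃ h, g = h⁻¹ := ⟨g⁻¹, (inv_inv g).symm⟩
  rw [inv_inv]
  rfl

open scoped Classical in
theorem crossedTrace_lamM_mul_piM (g : Γ) (b : B.toStarSubalgebra) :
    crossedTrace α τ (lamM α g * piM α b) = if g = 1 then τ b else 0 := by
  have h : (coef α (piM α b) g⁻¹) = if g = 1 then b else 0 := by
    refine Subtype.ext (ContinuousLinearMap.ext fun k => ?_)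
    rw [coef_apply, coe_piM, piRep_apply]
    split_ifs with hg
    · subst hg
      rw [inv_one, lp.single_apply_self, inv_one, act_one]
    · rw [lp.single_apply_ne _ _ _ (by simpa using hg), map_zero]
      rfl
  rw [crossedTrace_lamM_mul, h]
  split_ifs
  · rfl
  · exact map_zero τ

theorem crossedTrace_piM (b : B.toStarSubalgebra) : crossedTrace α τ (piM α b) = τ b := by
  classical
  have := crossedTrace_lamM_mul_piM α τ 1 b
  rwa [lamM_one, one_mul, if_pos rfl] at this

variable {α τ}

open scoped Classical in
theorem crossedTrace_normal (hτ : IsNormalFunctional B τ) :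
    IsNormalFunctional (crossedProduct α) (crossedTrace α τ) := by
  obtain ⟨ξ, η, hξ, hη, h⟩ := hτ
  refine ⟨fun n => lp.single 2 1 (ξ n), fun n => lp.single 2 1 (η n), ?_, ?_, fun x => ?_⟩
  · simpa only [lp.norm_single (p := 2) (by norm_num)] using hξ
  · simpa only [lp.norm_single (p := 2) (by norm_num)] using hη
  · simp only [lp.inner_single_left]
    exact h ⟨compress (x : L2 Γ K →L[ℂ] L2 Γ K), compress_mem α x.2⟩

/-- Parseval's identity `τ(x* x) = ∑ τ(x(g)* x(g))`. -/
theorem hasSum_coef (hτ : IsNormalFunctional B τ) (x : (crossedProduct α).toStarSubalgebra) :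
    HasSum (fun g => τ (star (coef α x g) * coef α x g)) (crossedTrace α τ (star x * x)) := by
  classical
  obtain ⟨ξ, η, hξ, hη, h⟩ := hτ
  let X : L2 Γ K →L[ℂ] L2 Γ K := x
  -- Square summability over both indices at once; it makes `F` below absolutely summable, so that
  -- its two iterated sums agree.
  have hsum : ∀ ζ : ℕ → K, Summable (fun n => ‖ζ n‖ ^ 2) →
      Summable fun p : ℕ × Γ => ‖X (lp.single 2 1 (ζ p.1)) p.2‖ ^ 2 := by
    intro ζ hζ
    rw [summable_prod_of_nonneg fun _ => by positivity]
    refine ⟨fun n => (hasSum_norm_sq (X (lp.single 2 1 (ζ n)))).summable, ?_⟩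
    have ht : ∀ n, ∑' g, ‖X (lp.single 2 1 (ζ n)) g‖ ^ 2 = ‖X (lp.single 2 1 (ζ n))‖ ^ 2 :=
      fun n => (hasSum_norm_sq _).tsum_eq
    simp only [ht]
    refine Summable.of_nonneg_of_le (fun _ => by positivity) (fun n => ?_) (hζ.mul_left (‖X‖ ^ 2))
    rw [← mul_pow]
    gcongr
    refine (X.le_opNorm _).trans_eq ?_
    rw [lp.norm_single (p := 2) (by norm_num)]
  let F : ℕ × Γ → ℂ := fun p =>
    inner ℂ (X (lp.single 2 1 (η p.1)) p.2) (X (lp.single 2 1 (ξ p.1)) p.2)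
  have hF : Summable F := by
    refine Summable.of_norm_bounded ((hsum η hη).add (hsum ξ hξ)) fun p => ?_
    refine (norm_inner_le_norm _ _).trans ?_
    nlinarith [sq_nonneg (‖X (lp.single 2 1 (η p.1)) p.2‖ - ‖X (lp.single 2 1 (ξ p.1)) p.2‖),
      sq_nonneg (‖X (lp.single 2 1 (η p.1)) p.2‖), sq_nonneg ‖X (lp.single 2 1 (ξ p.1)) p.2‖]
  -- Fubini: summing over `g` first yields `τ(x* x)`, summing over `n` first yields the traces of
  -- the `x(g)* x(g)`.
  have h1 : HasSum (fun n => (inner ℂ (X (lp.single 2 1 (η n))) (X (lp.single 2 1 (ξ n))) : ℂ))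
      (∑' p, F p) := hF.hasSum.prod_fiberwise fun n => lp.hasSum_inner _ _
  have h2 : HasSum (fun g => ∑' n, F (n, g)) (∑' p, F p) :=
    ((Equiv.prodComm Γ ℕ).hasSum_iff.2 hF.hasSum).prod_fiberwise fun g =>
      (hF.prod_symm.prod_factor g).hasSum
  have e1 : crossedTrace α τ (star x * x) = ∑' p, F p := by
    refine (h ⟨compress ((star x * x : (crossedProduct α).toStarSubalgebra) :
      L2 Γ K →L[ℂ] L2 Γ K), compress_mem α (star x * x).2⟩).unique ?_
    convert h1 using 2 with n
    rw [← ContinuousLinearMap.adjoint_inner_right X, lp.inner_single_left]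
    rfl
  rw [e1]
  refine h2.congr_fun fun g => ?_
  refine (h (star (coef α x g) * coef α x g)).unique ?_
  refine (hF.prod_symm.prod_factor g).hasSum.congr_fun fun n => ?_
  change inner ℂ (η n) (ContinuousLinearMap.adjoint (coef α x g : K →L[ℂ] K)
    ((coef α x g : K →L[ℂ] K) (ξ n))) = _
  rw [ContinuousLinearMap.adjoint_inner_right, coef_apply, coef_apply]
  rfl

theorem crossedTrace_nonneg (hτ : IsTrace B τ) (x : (crossedProduct α).toStarSubalgebra) :
    0 ≤ crossedTrace α τ (star x * x) :=
  (hasSum_coef hτ.normal x).nonneg fun _ => hτ.nonneg _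

/-- By normality, used in one variable at a time, it suffices to compare monomials. There both sides
vanish unless the group elements are mutually inverse, and then invariance under `α` and traciality
of `τ` on `B` conclude. -/
theorem crossedTrace_tracial (hτ : IsTrace B τ) (hα : ∀ g b, τ (α g b) = τ b)
    (x y : (crossedProduct α).toStarSubalgebra) :
    crossedTrace α τ (x * y) = crossedTrace α τ (y * x) := by
  classical
  obtain ⟨φ, hφ, h⟩ := (crossedTrace_normal (α := α) hτ.normal).exists_isUltraweak
  have hmono : ∀ p q : Γ × B.toStarSubalgebra,
      crossedTrace α τ ((lamM α p.1 * piM α p.2) * (lamM α q.1 * piM α q.2)) =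
        crossedTrace α τ ((lamM α q.1 * piM α q.2) * (lamM α p.1 * piM α p.2)) := by
    have e : ∀ p q : Γ × B.toStarSubalgebra,
        (lamM α p.1 * piM α p.2) * (lamM α q.1 * piM α q.2) =
          lamM α (p.1 * q.1) * piM α (α q.1⁻¹ p.2 * q.2) := by
      intro p q
      rw [mul_assoc, ← mul_assoc (piM α p.2), piM_mul_lamM, mul_assoc, piM_mul_piM, ← mul_assoc,
        lamM_mul_lamM]
    rintro ⟨g, a⟩ ⟨k, b⟩
    rw [e, e, crossedTrace_lamM_mul_piM, crossedTrace_lamM_mul_piM]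
    by_cases hgk : g * k = 1
    · obtain rfl : k = g⁻¹ := (inv_eq_of_mul_eq_one_right hgk).symm
      simp only [mul_inv_cancel, inv_mul_cancel, inv_inv, if_true]
      rw [← hα g⁻¹ (α g a * b), map_mul, ← act_mul, inv_mul_cancel, act_one, hτ.tracial]
    · rw [if_neg hgk, if_neg fun h' => hgk (mul_eq_one_comm.1 h')]
  have h1 : ∀ (q : Γ × B.toStarSubalgebra) (z : (crossedProduct α).toStarSubalgebra),
      crossedTrace α τ (z * (lamM α q.1 * piM α q.2)) =
        crossedTrace α τ ((lamM α q.1 * piM α q.2) * z) := by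
    intro q z
    rw [← h, ← h]
    refine (hφ.mul_right (lam K q.1 * piRep α q.2)).eqOn (hφ.mul_left (lam K q.1 * piRep α q.2))
      (isStable_monomials α) ?_ z.2
    rintro _ ⟨p, rfl⟩
    refine (h _).trans ((hmono p q).trans (h _).symm)
  rw [← h, ← h]
  refine (hφ.mul_left (x : L2 Γ K →L[ℂ] L2 Γ K)).eqOn (hφ.mul_right (x : L2 Γ K →L[ℂ] L2 Γ K))
    (isStable_monomials α) ?_ y.2
  rintro _ ⟨q, rfl⟩
  exact (h _).trans ((h1 q x).trans (h _).symm)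

/-- The canonical functional on the crossed product is a trace. -/
theorem crossedTrace_isTrace (hτ : IsTrace B τ) (hα : ∀ g b, τ (α g b) = τ b) :
    IsTrace (crossedProduct α) (crossedTrace α τ) where
  normal := crossedTrace_normal hτ.normal
  nonneg := crossedTrace_nonneg hτ
  tracial := crossedTrace_tracial hτ hα
  normalised := by rw [← piM_one, crossedTrace_piM, hτ.normalised]
  faithful x hx := by
    classical
    have h0 : norm₂ (crossedTrace α τ) x = 0 := by rw [norm₂, hx, Complex.zero_re, Real.sqrt_zero]
    -- Coefficients see only column `1` of an operator; right multiplication by `λ(h)` brings column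
    -- `h` of `x` there.
    have hcoef : ∀ h g, coef α (x * lamM α h) g = 0 := by
      intro h g
      have hz : crossedTrace α τ (star (x * lamM α h) * (x * lamM α h)) = 0 := by
        rw [star_mul, mul_assoc, crossedTrace_tracial hτ hα, mul_assoc, ← norm_le_zero_iff]
        refine (norm_map_star_mul_le (crossedTrace_nonneg hτ) x _).trans_eq ?_
        rw [h0, zero_mul]
      have hsum := hasSum_coef hτ.normal (x * lamM α h)
      rw [hz] at hsum
      exact hτ.faithful _ (congrFun ((hasSum_zero_iff_of_nonneg fun _ => hτ.nonneg _).1 hsum) g)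
    refine Subtype.ext (ext_single fun h v => lp.ext (funext fun g => ?_))
    have := DFunLike.congr_fun (congrArg Subtype.val (hcoef h g)) v
    rw [coef_apply] at this
    change (x : L2 Γ K →L[ℂ] L2 Γ K) (lam K h (lp.single 2 1 v)) g = 0 at this
    rwa [lam_single, mul_one] at this

end CrossedProduct

/-! ### Strong mixing of the subalgebra implies strong mixing of the action. -/

section Mixing

variable {K : Type*} [NormedAddCommGroup K] [InnerProductSpace ℂ K] [CompleteSpace K]
  {Γ : Type*} [Group Γ] {B : VonNeumannAlgebra K}
  {α : Γ →* (B.toStarSubalgebra ≃⋆ₐ[ℂ] B.toStarSubalgebra)} {τ : B.toStarSubalgebra →ₗ[ℂ] ℂ}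

open scoped Classical in
theorem crossedTrace_lamM (hτ : IsTrace B τ) (g : Γ) :
    crossedTrace α τ (lamM α g) = if g = 1 then 1 else 0 := by
  have := crossedTrace_lamM_mul_piM α τ g 1
  rwa [piM_one, mul_one, hτ.normalised] at this

/-- Independence of `π(B)` and `L(Γ)` under the trace, checked on `v = λ(g)` and extended by
normality. It is the reason why `E(π(b)) = τ(b)`. -/
theorem crossedTrace_piM_mul (hτ : IsTrace B τ) (hα : ∀ g b, τ (α g b) = τ b)
    (b : B.toStarSubalgebra) {v : (crossedProduct α).toStarSubalgebra}
    (hv : (v : L2 Γ K →L[ℂ] L2 Γ K) ∈ groupVN Γ K) :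
    crossedTrace α τ (piM α b * v) = τ b * crossedTrace α τ v := by
  classical
  obtain ⟨φ, hφ, h⟩ := (crossedTrace_normal (α := α) hτ.normal).exists_isUltraweak
  rw [← h, ← h]
  refine (hφ.mul_left (piRep α b)).eqOn (hφ.const_mul (τ b)) isStable_lam ?_ hv
  rintro _ ⟨g, rfl⟩
  have e1 : φ (piRep α b * lam K g) = crossedTrace α τ (piM α b * lamM α g) :=
    h (piM α b * lamM α g)
  have e2 : φ (lam K g) = crossedTrace α τ (lamM α g) := h (lamM α g)
  rw [e1, e2, piM_mul_lamM, crossedTrace_lamM_mul_piM, crossedTrace_lamM hτ, hα]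
  simp

theorem norm_sq_map_le (hτ : IsTrace B τ) (b : B.toStarSubalgebra) :
    ‖τ b‖ ^ 2 ≤ (τ (star b * b)).re := by
  rw [← norm₂_sq hτ.nonneg]
  gcongr
  exact hτ.norm_map_le b

theorem hasSum_coef_re (hτ : IsTrace B τ) (x : (crossedProduct α).toStarSubalgebra) :
    HasSum (fun g => (τ (star (coef α x g) * coef α x g)).re) (norm₂ (crossedTrace α τ) x ^ 2) := by
  rw [norm₂_sq (crossedTrace_nonneg hτ)]
  exact Complex.hasSum_re (hasSum_coef hτ.normal x)

theorem summable_norm_sq_coef (hτ : IsTrace B τ) (x : (crossedProduct α).toStarSubalgebra) :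
    Summable fun g => ‖τ (coef α x g)‖ ^ 2 :=
  Summable.of_nonneg_of_le (fun _ => by positivity) (fun _ => norm_sq_map_le hτ _)
    (hasSum_coef_re hτ x).summable

theorem sum_norm_sq_coef_le (hτ : IsTrace B τ) (x : (crossedProduct α).toStarSubalgebra)
    (s : Finset Γ) : ∑ g ∈ s, ‖τ (coef α x g)‖ ^ 2 ≤ norm₂ (crossedTrace α τ) x ^ 2 :=
  (Finset.sum_le_sum fun _ _ => norm_sq_map_le hτ _).trans
    (sum_le_hasSum _ (fun _ _ => (Complex.nonneg_iff.1 (hτ.nonneg _)).1) (hasSum_coef_re hτ x))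

theorem tendsto_coef (hτ : IsTrace B τ) (x : (crossedProduct α).toStarSubalgebra) :
    Tendsto (fun g => τ (coef α x g)) cofinite (𝓝 0) := by
  have h := (summable_norm_sq_coef hτ x).tendsto_cofinite_zero.sqrt
  rw [Real.sqrt_zero] at h
  refine tendsto_zero_iff_norm_tendsto_zero.2 (h.congr fun g => ?_)
  rw [Real.sqrt_sq (norm_nonneg _)]

theorem stronglyMixingAction_iff :
    StronglyMixingAction α τ ↔
      ∀ a b, Tendsto (fun g => τ (α g a * b) - τ a * τ b) cofinite (𝓝 0) := by
  classical
  constructor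
  · intro h a b
    rw [Metric.tendsto_nhds]
    intro ε hε
    obtain ⟨E, hE⟩ := h {a, b} ε hε
    filter_upwards [E.finite_toSet.compl_mem_cofinite] with g hg
    rw [dist_zero_right]
    exact hE a (by simp) b (by simp) g hg
  · intro h F ε hε
    have h1 : ∀ᶠ g in cofinite, ∀ a ∈ F, ∀ b ∈ F, ‖τ (α g a * b) - τ a * τ b‖ < ε := by
      simp only [eventually_all_finset]
      intro a _ b _
      have := (Metric.tendsto_nhds.1 (h a b)) ε hε
      simpa only [dist_zero_right] using this
    refine ⟨(eventually_cofinite.1 h1).toFinset, fun a ha b hb g hg => ?_⟩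
    rw [Set.Finite.mem_toFinset, Set.mem_ofPred_eq, not_not] at hg
    exact hg a ha b hb

variable (α) in
/-- `λ` as a homomorphism to the unitary group of the crossed product. -/
def lamUnitary : Γ →* unitary (crossedProduct α).toStarSubalgebra where
  toFun g := ⟨lamM α g, by
    rw [Unitary.mem_iff, star_lamM, lamM_mul_lamM, lamM_mul_lamM, inv_mul_cancel, mul_inv_cancel]
    exact ⟨lamM_one α, lamM_one α⟩⟩
  map_one' := Subtype.ext (lamM_one α)
  map_mul' g h := Subtype.ext (lamM_mul_lamM α g h).symm

theorem coe_lamUnitary (g : Γ) :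
    ((lamUnitary α g : unitary _) : (crossedProduct α).toStarSubalgebra) = lamM α g := rfl

theorem lamUnitary_injective (hτ : IsTrace B τ) : Function.Injective (lamUnitary α) := by
  refine (injective_iff_map_eq_one _).2 fun g hg => ?_
  by_contra hne
  have h1 : lamM α g = 1 := congrArg Subtype.val hg
  have h2 := crossedTrace_lamM (α := α) hτ g
  rw [if_neg hne, h1, ← lamM_one, crossedTrace_lamM hτ, if_pos rfl] at h2
  exact one_ne_zero h2

/-- `τ(λ(g) x)` is a Fourier coefficient of `x`, and these are square summable by Parseval, hence
vanish at infinity. -/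
theorem almostOrthonormal_range_lamUnitary [Infinite Γ] (hτ : IsTrace B τ) :
    AlmostOrthonormal (crossedTrace α τ)
      ((lamUnitary α).range : Set (unitary (crossedProduct α).toStarSubalgebra)) := by
  refine ⟨?_, fun x ε hε => ?_⟩
  · rw [MonoidHom.coe_range]
    exact Set.infinite_range_of_injective (lamUnitary_injective hτ)
  · have h1 : Tendsto (fun g => τ (coef α x g⁻¹)) cofinite (𝓝 0) :=
      (tendsto_coef hτ x).comp inv_injective.tendsto_cofinite
    have h2 := eventually_cofinite.1 ((Metric.tendsto_nhds.1 h1) ε hε)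
    refine ⟨_, h2.image (lamUnitary α), ?_, ?_⟩
    · rintro _ ⟨g, _, rfl⟩
      exact ⟨g, rfl⟩
    · rintro _ ⟨⟨g, rfl⟩, hg⟩
      rw [coe_lamUnitary, crossedTrace_lamM_mul]
      by_contra! hlt
      refine hg ⟨g, ?_, rfl⟩
      rw [Set.mem_ofPred_eq, dist_zero_right, not_lt]
      exact hlt.le

theorem coe_lamUnitary_inv (g : Γ) :
    (((lamUnitary α g)⁻¹ : unitary (crossedProduct α).toStarSubalgebra) :
      (crossedProduct α).toStarSubalgebra) = lamM α g⁻¹ := by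
  rw [← map_inv, coe_lamUnitary]

/-- By covariance `λ(g) π(a) λ(g)* π(b) = π(α_g(a) b)`, so the left side is the modulus of the trace
of the difference on the right. -/
theorem norm_correlation_le (hτ : IsTrace B τ) (hα : ∀ g b, τ (α g b) = τ b)
    {E : (crossedProduct α).toStarSubalgebra → (crossedProduct α).toStarSubalgebra}
    (hE : IsCondExp (crossedTrace α τ) (groupVN Γ K) E) (a b : B.toStarSubalgebra) (g : Γ) :
    ‖τ (α g a * b) - τ a * τ b‖ ≤ norm₂ (crossedTrace α τ)
      (E (lamM α g * piM α a * lamM α g⁻¹ * piM α b) - E (piM α a) * E (piM α b)) := by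
  have e1 : lamM α g * piM α a * lamM α g⁻¹ * piM α b = piM α (α g a * b) := by
    rw [lamM_mul_piM, mul_assoc (piM α _), lamM_mul_lamM, mul_inv_cancel, lamM_one, mul_one,
      piM_mul_piM]
  have hone : ((1 : (crossedProduct α).toStarSubalgebra) : L2 Γ K →L[ℂ] L2 Γ K) ∈ groupVN Γ K :=
    one_mem _
  have e2 : ∀ z, crossedTrace α τ (E z) = crossedTrace α τ z := fun z => by
    simpa using hE.2 z 1 hone
  have e3 : crossedTrace α τ (E (piM α (α g a * b)) - E (piM α a) * E (piM α b)) =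
      τ (α g a * b) - τ a * τ b := by
    rw [map_sub, e2, crossedTrace_piM, hE.2 _ _ (hE.1 _), crossedTrace_piM_mul hτ hα a (hE.1 _), e2,
      crossedTrace_piM]
  rw [← e3, e1]
  exact (crossedTrace_isTrace hτ hα).norm_map_le _

theorem stronglyMixingAction_of_stronglyMixingIn (hτ : IsTrace B τ)
    (hα : ∀ g b, τ (α g b) = τ b)
    (h : StronglyMixingIn (crossedTrace α τ) (groupVN Γ K)) : StronglyMixingAction α τ := by
  obtain ⟨E, hE, hmix⟩ := h
  -- For finite `Γ` the group `λ(Γ)` is finite and cannot serve as a test group, but mixing of the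
  -- action is then vacuous.
  rcases finite_or_infinite Γ with hfin | hinf
  · have := Fintype.ofFinite Γ
    exact fun F ε hε => ⟨Finset.univ, fun a _ b _ g hg => absurd (Finset.mem_univ g) hg⟩
  refine stronglyMixingAction_iff.2 fun a b => ?_
  have hG : ∀ u ∈ (lamUnitary α).range,
      ((u : (crossedProduct α).toStarSubalgebra) : L2 Γ K →L[ℂ] L2 Γ K) ∈ groupVN Γ K := by
    rintro _ ⟨g, rfl⟩
    exact lamM_mem α g
  have h1 := hmix (lamUnitary α).range hG (almostOrthonormal_range_lamUnitary hτ) (piM α a)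
    (piM α b)
  have hinj : Function.Injective (lamUnitary α).rangeRestrict :=
    (MonoidHom.rangeRestrict_injective_iff).2 (lamUnitary_injective hτ)
  refine squeeze_zero_norm (fun g => ?_) (h1.comp hinj.tendsto_cofinite)
  refine (norm_correlation_le hτ hα hE a b g).trans_eq ?_
  rw [← coe_lamUnitary_inv]
  rfl

end Mixing

/-! ### Convolution operators and existence of the conditional expectation. -/

section Convolution

variable {K : Type*} [NormedAddCommGroup K] [InnerProductSpace ℂ K] [CompleteSpace K]
  {Γ : Type*} [CommGroup Γ]

/-- Convolution by `f` is bounded by `C` on finitely supported functions. -/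
def IsConvBounded (f : Γ → ℂ) (C : ℝ) : Prop :=
  ∀ (ψ : Γ → ℂ) (F s : Finset Γ),
    ∑ g ∈ s, ‖∑ k ∈ F, f (g * k⁻¹) * ψ k‖ ^ 2 ≤ C ^ 2 * ∑ k ∈ F, ‖ψ k‖ ^ 2

namespace IsConvBounded

variable {f : Γ → ℂ} {C : ℝ}

theorem summable_sq (hf : IsConvBounded f C) : Summable fun g => ‖f g‖ ^ 2 := by
  refine summable_of_sum_le (c := C ^ 2) (fun _ => by positivity) fun s => ?_
  -- Convolving `f` with the point mass at `1` returns `f`.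
  simpa using hf (fun _ => 1) {1} s

theorem summable_smul (hf : IsConvBounded f C) (ξ : L2 Γ K) (g : Γ) :
    Summable fun k => f (g * k⁻¹) • ξ k := by
  have hinj : Function.Injective fun k : Γ => g * k⁻¹ := fun a b h => by simpa using h
  have h1 : Summable fun k => ‖f (g * k⁻¹)‖ ^ 2 := hf.summable_sq.comp_injective hinj
  refine Summable.of_norm_bounded (h1.add (hasSum_norm_sq ξ).summable) fun k => ?_
  rw [norm_smul]
  nlinarith [sq_nonneg (‖f (g * k⁻¹)‖ - ‖ξ k‖), sq_nonneg ‖f (g * k⁻¹)‖, sq_nonneg ‖ξ k‖]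

/-- The scalar bound applies to each coordinate in a Hilbert basis of `K`; summing over the basis
gives the vector-valued bound. -/
theorem sum_norm_sq_le (hf : IsConvBounded f C) (ψ : Γ → K) (F s : Finset Γ) :
    ∑ g ∈ s, ‖∑ k ∈ F, f (g * k⁻¹) • ψ k‖ ^ 2 ≤ C ^ 2 * ∑ k ∈ F, ‖ψ k‖ ^ 2 := by
  obtain ⟨w, b, -⟩ := exists_hilbertBasis ℂ K
  have hb : ∀ v : K, HasSum (fun i => ‖b.repr v i‖ ^ 2) (‖v‖ ^ 2) := fun v => by
    rw [← b.repr.norm_map v]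
    exact hasSum_norm_sq (b.repr v)
  refine hasSum_le (fun i => ?_) (hasSum_sum fun g _ => hb (∑ k ∈ F, f (g * k⁻¹) • ψ k))
    ((hasSum_sum fun k _ => hb (ψ k)).mul_left (C ^ 2))
  have := hf (fun k => b.repr (ψ k) i) F s
  simpa only [map_sum, map_smul, lp.coeFn_sum, Finset.sum_apply, lp.coeFn_smul, Pi.smul_apply,
    smul_eq_mul] using this

theorem sum_norm_sq_tsum_le (hf : IsConvBounded f C) (ξ : L2 Γ K) (s : Finset Γ) :
    ∑ g ∈ s, ‖∑' k, f (g * k⁻¹) • ξ k‖ ^ 2 ≤ C ^ 2 * ‖ξ‖ ^ 2 := by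
  refine le_of_tendsto_of_tendsto
    (tendsto_finsetSum s fun g _ => ((hf.summable_smul ξ g).hasSum.norm.pow 2))
    ((hasSum_norm_sq ξ).mul_left (C ^ 2)) (Eventually.of_forall fun F => ?_)
  beta_reduce
  rw [← Finset.mul_sum]
  exact hf.sum_norm_sq_le (fun k => ξ k) F s

/-- Convolution by `f` as an operator on `ℓ²(Γ, K)`. -/
def convOp (hf : IsConvBounded f C) : L2 Γ K →L[ℂ] L2 Γ K :=
  LinearMap.mkContinuous
    { toFun := fun ξ => toL2 (fun g => ∑' k, f (g * k⁻¹) • ξ k)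
        (summable_of_sum_le (fun _ => by positivity) (hf.sum_norm_sq_tsum_le ξ))
      map_add' := fun ξ η => by
        ext g
        change ∑' k, f (g * k⁻¹) • (ξ k + η k) = _
        simp only [smul_add]
        exact (hf.summable_smul ξ g).tsum_add (hf.summable_smul η g)
      map_smul' := fun c ξ => by
        ext g
        change ∑' k, f (g * k⁻¹) • (c • ξ k) = _
        simp only [smul_comm _ c]
        exact (hf.summable_smul ξ g).tsum_const_smul c } |C| fun ξ => by
    -- Only `C ^ 2` enters the hypothesis and `C` may be negative, hence the bound `|C|`.
    refine abs_le_of_sq_le_sq' ?_ (by positivity) |>.2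
    rw [mul_pow, sq_abs]
    exact hasSum_le_of_sum_le (hasSum_norm_sq _) (hf.sum_norm_sq_tsum_le ξ)

theorem convOp_apply (hf : IsConvBounded f C) (ξ : L2 Γ K) (g : Γ) :
    hf.convOp ξ g = ∑' k, f (g * k⁻¹) • ξ k := rfl

open scoped Classical in
theorem convOp_single (hf : IsConvBounded f C) (h : Γ) (v : K) (g : Γ) :
    hf.convOp (lp.single 2 h v) g = f (g * h⁻¹) • v := by
  rw [convOp_apply, tsum_eq_single h, lp.single_apply_self]
  intro k hk
  rw [lp.single_apply_ne _ _ _ hk, smul_zero]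

/-- An operator commuting with every `λ(k)` is determined by its column at `1`, so it is itself a
convolution; convolutions commute because `Γ` is abelian. -/
theorem convOp_mem (hf : IsConvBounded f C) : hf.convOp ∈ groupVN Γ K := by
  classical
  refine mem_generatedBy_iff.2 fun c hc => ext_single fun h v => lp.ext (funext fun g => ?_)
  have hcs : ∀ k w, c (lp.single 2 k w) = lam K k (c (lp.single 2 1 w)) := by
    intro k w
    have := DFunLike.congr_fun (hc (lam K k) ⟨k, rfl⟩).1 (lp.single 2 1 w)
    change lam K k (c (lp.single 2 1 w)) = c (lam K k (lp.single 2 1 w)) at this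
    rw [this, lam_single, mul_one]
  have h1 := ((lp.hasSum_single (p := 2) (by norm_num) (hf.convOp (lp.single 2 h v))).mapL c).mapL
    (lp.evalCLM ℂ (fun _ : Γ => K) 2 g)
  refine h1.unique ?_
  change HasSum _ (hf.convOp (c (lp.single 2 h v)) g)
  rw [convOp_apply]
  -- The substitution `k ↦ g h / k` exchanges the two convolution sums.
  refine ((Equiv.divLeft (g * h)).hasSum_iff.2
    (hf.summable_smul (c (lp.single 2 h v)) g).hasSum).congr_fun fun k => ?_
  have a2 : h⁻¹ * (g * h / k) = k⁻¹ * g := by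
    rw [div_eq_mul_inv, mul_comm g h, mul_assoc, inv_mul_cancel_left, mul_comm]
  have a1 : g * (g * h / k)⁻¹ = k * h⁻¹ := by
    rw [mul_inv_eq_iff_eq_mul, mul_assoc, a2, mul_inv_cancel_left]
  change c (lp.single 2 k (hf.convOp (lp.single 2 h v) k)) g =
    f (g * (g * h / k)⁻¹) • c (lp.single 2 h v) (g * h / k)
  rw [convOp_single, lp.single_smul, map_smul, lp.coeFn_smul, Pi.smul_apply, hcs k, hcs h, lam_apply,
    lam_apply]
  rw [a1, a2]

end IsConvBounded

variable {B : VonNeumannAlgebra K}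
  {α : Γ →* (B.toStarSubalgebra ≃⋆ₐ[ℂ] B.toStarSubalgebra)} {τ : B.toStarSubalgebra →ₗ[ℂ] ℂ}

theorem norm₂_sum_smul_lamM_sq (hτ : IsTrace B τ) (ψ : Γ → ℂ) (F : Finset Γ) :
    norm₂ (crossedTrace α τ) (∑ k ∈ F, ψ k • lamM α k) ^ 2 = ∑ k ∈ F, ‖ψ k‖ ^ 2 := by
  classical
  rw [norm₂_sq (crossedTrace_nonneg hτ)]
  have : crossedTrace α τ (star (∑ k ∈ F, ψ k • lamM α k) * ∑ k ∈ F, ψ k • lamM α k) =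
      ((∑ k ∈ F, ‖ψ k‖ ^ 2 : ℝ) : ℂ) := by
    rw [star_sum, Finset.sum_mul, map_sum, Complex.ofReal_sum]
    refine Finset.sum_congr rfl fun j hj => ?_
    rw [Finset.mul_sum, map_sum, Finset.sum_eq_single j]
    · rw [star_smul, star_lamM, smul_mul_smul_comm, lamM_mul_lamM, map_smul, crossedTrace_lamM hτ,
        inv_mul_cancel, if_pos rfl, smul_eq_mul, mul_one, RCLike.star_def, Complex.conj_mul']
      norm_cast
    · intro k _ hk
      rw [star_smul, star_lamM, smul_mul_smul_comm, lamM_mul_lamM, map_smul, crossedTrace_lamM hτ,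
        if_neg, smul_zero]
      rw [inv_mul_eq_one]
      exact hk.symm
    · exact fun h => absurd hj h
  rw [this, Complex.ofReal_re]

/-- Convolving the coefficients of `x` with `ψ` gives those of `a x`, where `a = ∑ ψ(k) λ(k)`. The
bound is then `‖a x‖₂ ≤ ‖a‖₂ ‖x‖`. -/
theorem isConvBounded_coef (hτ : IsTrace B τ) (hα : ∀ g b, τ (α g b) = τ b)
    (x : (crossedProduct α).toStarSubalgebra) : IsConvBounded (fun g => τ (coef α x g)) ‖x‖ := by
  intro ψ F s
  have hT := crossedTrace_isTrace hτ hα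
  have e : ∀ g, ∑ k ∈ F, τ (coef α x (g * k⁻¹)) * ψ k =
      τ (coef α ((∑ k ∈ F, ψ k • lamM α k) * x) g) := by
    intro g
    have h1 := crossedTrace_lamM_mul α τ ((∑ k ∈ F, ψ k • lamM α k) * x) g⁻¹
    rw [inv_inv] at h1
    rw [← h1, ← mul_assoc, Finset.mul_sum, Finset.sum_mul, map_sum]
    refine Finset.sum_congr rfl fun k _ => ?_
    rw [mul_smul_comm, smul_mul_assoc, lamM_mul_lamM, map_smul, crossedTrace_lamM_mul, smul_eq_mul,
      mul_comm, mul_inv_rev, inv_inv, mul_comm g]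
  simp only [e]
  refine (sum_norm_sq_coef_le hτ _ s).trans ?_
  rw [← norm₂_sum_smul_lamM_sq (α := α) hτ, mul_comm, ← mul_pow]
  gcongr
  · exact norm₂_nonneg _
  · exact hT.norm₂_mul_le_mul_norm _ _

/-- The conditional expectation of the crossed product onto `L(Γ)`. -/
def condExp (hτ : IsTrace B τ) (hα : ∀ g b, τ (α g b) = τ b)
    (x : (crossedProduct α).toStarSubalgebra) : (crossedProduct α).toStarSubalgebra :=
  ⟨(isConvBounded_coef hτ hα x).convOp,
    mem_crossedProduct_of_mem_groupVN α (IsConvBounded.convOp_mem _)⟩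

theorem coef_condExp (hτ : IsTrace B τ) (hα : ∀ g b, τ (α g b) = τ b)
    (x : (crossedProduct α).toStarSubalgebra) (g : Γ) :
    coef α (condExp hτ hα x) g = τ (coef α x g) • (1 : B.toStarSubalgebra) := by
  classical
  refine Subtype.ext (ContinuousLinearMap.ext fun k => ?_)
  rw [coef_apply]
  refine (IsConvBounded.convOp_single _ _ _ _).trans ?_
  rw [inv_one, mul_one]
  rfl

/-- By normality it suffices to test on `λ(g)`, where both sides are the same Fourier coefficient.
-/
theorem isCondExp_condExp (hτ : IsTrace B τ) (hα : ∀ g b, τ (α g b) = τ b) :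
    IsCondExp (crossedTrace α τ) (groupVN Γ K) (condExp (α := α) hτ hα) := by
  refine ⟨fun x => IsConvBounded.convOp_mem _, fun x a ha => ?_⟩
  have hT := crossedTrace_isTrace hτ hα
  obtain ⟨φ, hφ, h⟩ := hT.normal.exists_isUltraweak
  rw [← h, ← h]
  refine (hφ.mul_left (condExp hτ hα x : L2 Γ K →L[ℂ] L2 Γ K)).eqOn
    (hφ.mul_left (x : L2 Γ K →L[ℂ] L2 Γ K)) isStable_lam ?_ ha
  rintro _ ⟨g, rfl⟩
  have e1 : φ (condExp hτ hα x * lam K g) = crossedTrace α τ (condExp hτ hα x * lamM α g) :=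
    h (condExp hτ hα x * lamM α g)
  have e2 : φ (x * lam K g) = crossedTrace α τ (x * lamM α g) := h (x * lamM α g)
  rw [e1, e2, hT.tracial, hT.tracial x, crossedTrace_lamM_mul, crossedTrace_lamM_mul, coef_condExp,
    map_smul, hτ.normalised, smul_eq_mul, mul_one]

end Convolution

/-! ### Averages of a function vanishing at infinity. -/

section Limits

theorem tendsto_zero_of_approx {ι : Type*} {l : Filter ι} {f : ι → ℝ} (hf : ∀ i, 0 ≤ f i)
    (h : ∀ ε > 0, ∃ f' : ι → ℝ, Tendsto f' l (𝓝 0) ∧ ∀ i, f i ≤ f' i + ε) :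
    Tendsto f l (𝓝 0) := by
  refine tendsto_order.2 ⟨fun a ha => Eventually.of_forall fun i => ha.trans_le (hf i),
    fun ε hε => ?_⟩
  obtain ⟨f', hf', hle⟩ := h (ε / 2) (half_pos hε)
  filter_upwards [(tendsto_order.1 hf').2 (ε / 2) (half_pos hε)] with i hi
  linarith [hle i]

/-- Off the finite set where `q ≥ ε` the average contributes at most `ε`; on that set the weights
tend to `0`. -/
theorem tendsto_weighted_sum_zero {ι Γ : Type*} {l : Filter ι} {p : ι → Γ → ℝ} {q : Γ → ℝ}
    {S : ι → ℝ} (hp : ∀ i g, 0 ≤ p i g) (hp1 : ∀ i, HasSum (p i) 1)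
    (hp0 : ∀ g, Tendsto (fun i => p i g) l (𝓝 0)) (hq : ∀ g, 0 ≤ q g)
    (hq0 : Tendsto q cofinite (𝓝 0)) (hS : ∀ i, HasSum (fun g => p i g * q g) (S i)) :
    Tendsto S l (𝓝 0) := by
  classical
  refine tendsto_zero_of_approx (fun i => (hS i).nonneg fun g => mul_nonneg (hp i g) (hq g))
    fun ε hε => ?_
  have hfin := eventually_cofinite.1 ((tendsto_order.1 hq0).2 ε hε)
  refine ⟨fun i => ∑ g ∈ hfin.toFinset, p i g * q g, ?_, fun i => ?_⟩
  · rw [← Finset.sum_const_zero (s := hfin.toFinset)]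
    refine tendsto_finsetSum _ fun g _ => ?_
    simpa using (hp0 g).mul_const (q g)
  · have h1 : HasSum (fun g => (if g ∈ hfin.toFinset then p i g * q g else 0) + ε * p i g)
        (∑ g ∈ hfin.toFinset, p i g * q g + ε * 1) := by
      refine HasSum.add ?_ ((hp1 i).mul_left ε)
      rw [← Finset.sum_congr rfl fun g hg => if_pos hg]
      exact hasSum_sum_of_ne_finset_zero fun g hg => if_neg hg
    rw [mul_one] at h1
    refine hasSum_le (fun g => ?_) (hS i) h1
    split_ifs with hg
    · have := mul_nonneg hε.le (hp i g)
      linarith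
    · rw [Set.Finite.mem_toFinset, Set.mem_ofPred_eq, not_not] at hg
      rw [zero_add, mul_comm]
      exact mul_le_mul_of_nonneg_right hg.le (hp i g)

end Limits

/-! ### Linearity and uniform continuity of the defect in each variable. -/

section Defect

variable {H : Type*} [NormedAddCommGroup H] [InnerProductSpace ℂ H] [CompleteSpace H]
variable {M : VonNeumannAlgebra H} {τ : M.toStarSubalgebra →ₗ[ℂ] ℂ} {A : VonNeumannAlgebra H}
  {E : M.toStarSubalgebra → M.toStarSubalgebra}

theorem IsCondExp.map_smul (hE : IsCondExp τ A E) (hτ : IsTrace M τ) (c : ℂ)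
    (x : M.toStarSubalgebra) : E (c • x) = c • E x :=
  hE.eq_of_forall hτ (A.toStarSubalgebra.smul_mem (hE.1 x) c) fun a ha => by
    rw [smul_mul_assoc, smul_mul_assoc, _root_.map_smul, _root_.map_smul, hE.2 _ _ ha]

theorem IsTrace.norm_map_star (hτ : IsTrace M τ) (x : M.toStarSubalgebra) :
    ‖τ (star x)‖ = ‖τ x‖ := by
  rw [map_star_of_nonneg hτ.nonneg, RCLike.norm_conj]

theorem map_mul_sub_smul (c : ℂ) (x y z : M.toStarSubalgebra) :
    τ (x * (y - c • z)) = τ (x * y) - c * τ (x * z) := by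
  rw [mul_sub, map_sub, mul_smul_comm, map_smul, smul_eq_mul]

/-- The difference `E(u x u⁻¹ y) - E(x) E(y)`. -/
def defect (E : M.toStarSubalgebra → M.toStarSubalgebra) (u : unitary M.toStarSubalgebra)
    (x y : M.toStarSubalgebra) : M.toStarSubalgebra :=
  E ((u : M.toStarSubalgebra) * x * ((u⁻¹ : unitary M.toStarSubalgebra) : M.toStarSubalgebra) * y) -
    E x * E y

theorem defect_add_left (hE : IsCondExp τ A E) (hτ : IsTrace M τ) (u : unitary M.toStarSubalgebra)
    (x x' y : M.toStarSubalgebra) : defect E u (x + x') y = defect E u x y + defect E u x' y := by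
  simp only [defect, mul_add, add_mul, hE.map_add hτ]
  abel

theorem defect_add_right (hE : IsCondExp τ A E) (hτ : IsTrace M τ) (u : unitary M.toStarSubalgebra)
    (x y y' : M.toStarSubalgebra) : defect E u x (y + y') = defect E u x y + defect E u x y' := by
  simp only [defect, mul_add, hE.map_add hτ]
  abel

theorem defect_smul_left (hE : IsCondExp τ A E) (hτ : IsTrace M τ) (u : unitary M.toStarSubalgebra)
    (c : ℂ) (x y : M.toStarSubalgebra) : defect E u (c • x) y = c • defect E u x y := by
  simp only [defect, mul_smul_comm, smul_mul_assoc, hE.map_smul hτ, smul_sub]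

theorem defect_smul_right (hE : IsCondExp τ A E) (hτ : IsTrace M τ) (u : unitary M.toStarSubalgebra)
    (c : ℂ) (x y : M.toStarSubalgebra) : defect E u x (c • y) = c • defect E u x y := by
  simp only [defect, mul_smul_comm, hE.map_smul hτ, smul_sub]

theorem defect_mul_left (hE : IsCondExp τ A E) (hτ : IsTrace M τ) {u : unitary M.toStarSubalgebra}
    {a : M.toStarSubalgebra} (ha : (a : H →L[ℂ] H) ∈ A)
    (hau : a * (u : M.toStarSubalgebra) = u * a) (x y : M.toStarSubalgebra) :
    defect E u (a * x) y = a * defect E u x y := by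
  rw [defect, ← mul_assoc (u : M.toStarSubalgebra) a, ← hau, defect, mul_sub, ← hE.map_mul_left hτ ha,
    hE.map_mul_left hτ ha x]
  simp only [mul_assoc]

theorem defect_mul_right (hE : IsCondExp τ A E) (hτ : IsTrace M τ) {u : unitary M.toStarSubalgebra}
    {a : M.toStarSubalgebra} (ha : (a : H →L[ℂ] H) ∈ A) (x y : M.toStarSubalgebra) :
    defect E u x (y * a) = defect E u x y * a := by
  rw [defect, ← mul_assoc, hE.map_mul_right hτ ha, hE.map_mul_right hτ ha, defect, sub_mul,
    mul_assoc (E x)]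

/-- The constant does not depend on `u`, so approximation of `y` in `‖·‖₂` survives the limit `u →
∞`; likewise for `x` in the next lemma. -/
theorem norm₂_defect_le_right (hE : IsCondExp τ A E) (hτ : IsTrace M τ)
    (u : unitary M.toStarSubalgebra) (x y : M.toStarSubalgebra) :
    norm₂ τ (defect E u x y) ≤ (‖x‖ + ‖E x‖) * norm₂ τ y := by
  refine (hτ.norm₂_sub_le _ _).trans ?_
  rw [add_mul]
  refine add_le_add ((hE.norm₂_le hτ _).trans ?_)
    ((norm₂_mul_le_norm_mul hτ.nonneg _ _).trans (by gcongr; exact hE.norm₂_le hτ y))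
  rw [mul_assoc, mul_assoc, IsTrace.norm₂_mul_of_star_mul_self (Unitary.coe_star_mul_self u)]
  refine (norm₂_mul_le_norm_mul hτ.nonneg _ _).trans_eq ?_
  rw [IsTrace.norm₂_mul_of_star_mul_self (Unitary.coe_star_mul_self u⁻¹)]

theorem norm₂_defect_le_left (hE : IsCondExp τ A E) (hτ : IsTrace M τ)
    (u : unitary M.toStarSubalgebra) (x y : M.toStarSubalgebra) :
    norm₂ τ (defect E u x y) ≤ (‖y‖ + ‖E y‖) * norm₂ τ x := by
  refine (hτ.norm₂_sub_le _ _).trans ?_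
  rw [add_mul, mul_comm ‖y‖, mul_comm ‖E y‖]
  refine add_le_add ((hE.norm₂_le hτ _).trans ?_)
    ((hτ.norm₂_mul_le_mul_norm _ _).trans (by gcongr; exact hE.norm₂_le hτ x))
  refine (hτ.norm₂_mul_le_mul_norm _ _).trans_eq ?_
  rw [hτ.norm₂_mul_of_mul_star_self (Unitary.coe_mul_star_self u⁻¹),
    IsTrace.norm₂_mul_of_star_mul_self (Unitary.coe_star_mul_self u)]

theorem norm₂_smul (c : ℂ) (x : M.toStarSubalgebra) : norm₂ τ (c • x) = ‖c‖ * norm₂ τ x := by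
  rw [norm₂, norm₂, star_smul, smul_mul_smul_comm, map_smul, RCLike.star_def, Complex.conj_mul',
    smul_eq_mul, ← Complex.ofReal_pow, Complex.re_ofReal_mul, Real.sqrt_mul (by positivity),
    Real.sqrt_sq (norm_nonneg _)]

/-- `‖E(u x u⁻¹ y) - E(x) E(y)‖₂ → 0` as `u → ∞` in `G`. -/
def MixesPair (τ : M.toStarSubalgebra →ₗ[ℂ] ℂ) (E : M.toStarSubalgebra → M.toStarSubalgebra)
    (G : Subgroup (unitary M.toStarSubalgebra)) (x y : M.toStarSubalgebra) : Prop :=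
  Tendsto (fun u : G => norm₂ τ (defect E u x y)) cofinite (𝓝 0)

namespace MixesPair

variable {G : Subgroup (unitary M.toStarSubalgebra)}

theorem of_approx_right (hE : IsCondExp τ A E) (hτ : IsTrace M τ) {x y : M.toStarSubalgebra}
    (h : ∀ ε > 0, ∃ y', MixesPair τ E G x y' ∧ norm₂ τ (y - y') < ε) : MixesPair τ E G x y := by
  refine tendsto_zero_of_approx (fun _ => norm₂_nonneg _) fun ε hε => ?_
  -- The summand `1` keeps the constant positive when both norms vanish.
  have hC : 0 < ‖x‖ + ‖E x‖ + 1 := by positivity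
  obtain ⟨y', hy', hlt⟩ := h (ε / (‖x‖ + ‖E x‖ + 1)) (by positivity)
  refine ⟨_, hy', fun u => ?_⟩
  rw [← add_sub_cancel y' y, defect_add_right hE hτ]
  refine (norm₂_add_le hτ.nonneg _ _).trans (add_le_add le_rfl ?_)
  refine (norm₂_defect_le_right hE hτ _ _ _).trans ?_
  rw [lt_div_iff₀ hC] at hlt
  nlinarith [norm₂_nonneg (τ := τ) (y - y')]

theorem of_approx_left (hE : IsCondExp τ A E) (hτ : IsTrace M τ) {x y : M.toStarSubalgebra}
    (h : ∀ ε > 0, ∃ x', MixesPair τ E G x' y ∧ norm₂ τ (x - x') < ε) : MixesPair τ E G x y := by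
  refine tendsto_zero_of_approx (fun _ => norm₂_nonneg _) fun ε hε => ?_
  have hC : 0 < ‖y‖ + ‖E y‖ + 1 := by positivity
  obtain ⟨x', hx', hlt⟩ := h (ε / (‖y‖ + ‖E y‖ + 1)) (by positivity)
  refine ⟨_, hx', fun u => ?_⟩
  rw [← add_sub_cancel x' x, defect_add_left hE hτ]
  refine (norm₂_add_le hτ.nonneg _ _).trans (add_le_add le_rfl ?_)
  refine (norm₂_defect_le_left hE hτ _ _ _).trans ?_
  rw [lt_div_iff₀ hC] at hlt
  nlinarith [norm₂_nonneg (τ := τ) (x - x')]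

theorem span_right (hE : IsCondExp τ A E) (hτ : IsTrace M τ) {x : M.toStarSubalgebra}
    {Y : Set M.toStarSubalgebra} (h : ∀ y ∈ Y, MixesPair τ E G x y) {y : M.toStarSubalgebra}
    (hy : y ∈ Submodule.span ℂ Y) : MixesPair τ E G x y := by
  induction hy using Submodule.span_induction with
  | mem y hy => exact h y hy
  | zero => simpa [MixesPair, defect, hE.map_zero hτ] using tendsto_const_nhds
  | add y z _ _ hy hz =>
    refine squeeze_zero (fun _ => norm₂_nonneg _) (fun u => ?_)
      (by simpa using Tendsto.add hy hz)
    rw [defect_add_right hE hτ]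
    exact norm₂_add_le hτ.nonneg _ _
  | smul c y _ hy =>
    simpa [MixesPair, defect_smul_right hE hτ, norm₂_smul] using Tendsto.const_mul ‖c‖ hy

theorem span_left (hE : IsCondExp τ A E) (hτ : IsTrace M τ) {y : M.toStarSubalgebra}
    {X : Set M.toStarSubalgebra} (h : ∀ x ∈ X, MixesPair τ E G x y) {x : M.toStarSubalgebra}
    (hx : x ∈ Submodule.span ℂ X) : MixesPair τ E G x y := by
  induction hx using Submodule.span_induction with
  | mem x hx => exact h x hx
  | zero => simpa [MixesPair, defect, hE.map_zero hτ] using tendsto_const_nhds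
  | add x z _ _ hx hz =>
    refine squeeze_zero (fun _ => norm₂_nonneg _) (fun u => ?_)
      (by simpa using Tendsto.add hx hz)
    rw [defect_add_left hE hτ]
    exact norm₂_add_le hτ.nonneg _ _
  | smul c x _ hx =>
    simpa [MixesPair, defect_smul_left hE hτ, norm₂_smul] using Tendsto.const_mul ‖c‖ hx

theorem mul_left (hE : IsCondExp τ A E) (hτ : IsTrace M τ) {x y a : M.toStarSubalgebra}
    (h : MixesPair τ E G x y) (ha : (a : H →L[ℂ] H) ∈ A)
    (hau : ∀ u ∈ G, a * (u : M.toStarSubalgebra) = u * a) : MixesPair τ E G (a * x) y := by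
  refine squeeze_zero (fun _ => norm₂_nonneg _) (fun u => ?_)
    (by simpa using Tendsto.const_mul ‖a‖ h)
  rw [defect_mul_left hE hτ ha (hau u u.2)]
  exact norm₂_mul_le_norm_mul hτ.nonneg _ _

theorem mul_right (hE : IsCondExp τ A E) (hτ : IsTrace M τ) {x y a : M.toStarSubalgebra}
    (h : MixesPair τ E G x y) (ha : (a : H →L[ℂ] H) ∈ A) : MixesPair τ E G x (y * a) := by
  refine squeeze_zero (fun _ => norm₂_nonneg _) (fun u => ?_)
    (by simpa using Tendsto.mul_const ‖a‖ h)
  rw [defect_mul_right hE hτ ha]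
  exact hτ.norm₂_mul_le_mul_norm _ _

end MixesPair

theorem AlmostOrthonormal.tendsto {G : Subgroup (unitary M.toStarSubalgebra)}
    (h : AlmostOrthonormal τ (G : Set (unitary M.toStarSubalgebra))) (x : M.toStarSubalgebra) :
    Tendsto (fun u : G => τ (((u : unitary M.toStarSubalgebra) : M.toStarSubalgebra) * x))
      cofinite (𝓝 0) := by
  rw [Metric.tendsto_nhds]
  intro ε hε
  -- Almost orthonormality bounds with `≤`; halving `ε` makes the inequality strict.
  obtain ⟨F, hF, -, hle⟩ := h.2 x (ε / 2) (half_pos hε)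
  refine eventually_cofinite.2
    ((hF.preimage (f := ((↑) : G → unitary M.toStarSubalgebra))
      Subtype.val_injective.injOn).subset fun u hu => ?_)
  by_contra hnot
  refine hu ?_
  rw [dist_zero_right]
  exact (hle u ⟨u.2, hnot⟩).trans_lt (half_lt_self hε)

end Defect

/-! ### Strong mixing of the action implies strong mixing of the subalgebra. -/

section Mixing

variable {K : Type*} [NormedAddCommGroup K] [InnerProductSpace ℂ K] [CompleteSpace K]
  {Γ : Type*} [CommGroup Γ] {B : VonNeumannAlgebra K}
  {α : Γ →* (B.toStarSubalgebra ≃⋆ₐ[ℂ] B.toStarSubalgebra)} {τ : B.toStarSubalgebra →ₗ[ℂ] ℂ}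

theorem lamM_comm {v : (crossedProduct α).toStarSubalgebra}
    (hv : (v : L2 Γ K →L[ℂ] L2 Γ K) ∈ groupVN Γ K) (g : Γ) : lamM α g * v = v * lamM α g := by
  refine Subtype.ext (mem_generatedBy_iff.1 hv (lam K g) ?_)
  rintro _ ⟨h, rfl⟩
  rw [star_lam, lam_mul_lam, lam_mul_lam, lam_mul_lam, lam_mul_lam, mul_comm h, mul_comm h⁻¹]
  exact ⟨rfl, rfl⟩

/-- By independence `τ(b v(g)) = τ(b) τ(v(g))` for every `b`, so `v(g) - τ(v(g))` is orthogonal to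
all of `B`, in particular to itself. This turns the Parseval identity on `L(Γ)` into one for scalar
coefficients. -/
theorem coef_eq_smul_one (hτ : IsTrace B τ) (hα : ∀ g b, τ (α g b) = τ b)
    {v : (crossedProduct α).toStarSubalgebra} (hv : (v : L2 Γ K →L[ℂ] L2 Γ K) ∈ groupVN Γ K)
    (g : Γ) : coef α v g = τ (coef α v g) • (1 : B.toStarSubalgebra) := by
  have h1 : ∀ b, τ (b * coef α v g) = τ b * τ (coef α v g) := by
    intro b
    have h2 := crossedTrace_piM_mul hτ hα b (v := lamM α g⁻¹ * v) (mul_mem (lamM_mem α g⁻¹) hv)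
    rw [crossedTrace_lamM_mul, inv_inv] at h2
    rw [← h2]
    refine congrArg τ (Subtype.ext (ContinuousLinearMap.ext fun k => ?_))
    classical
    change (b : K →L[ℂ] K) ((coef α v g : K →L[ℂ] K) k) = ((α 1⁻¹ b : B.toStarSubalgebra) : K →L[ℂ] K)
      (lam K g⁻¹ ((v : L2 Γ K →L[ℂ] L2 Γ K) (lp.single 2 1 k)) 1)
    rw [inv_one, act_one, coef_apply, lam_apply, inv_inv, mul_one]
  refine sub_eq_zero.1 (hτ.faithful _ ?_)
  rw [mul_sub, map_sub, h1, mul_smul_comm, mul_one, map_smul, smul_eq_mul, mul_comm, sub_self]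

theorem hasSum_norm_sq_coef (hτ : IsTrace B τ) (hα : ∀ g b, τ (α g b) = τ b)
    {v : (crossedProduct α).toStarSubalgebra} (hv : (v : L2 Γ K →L[ℂ] L2 Γ K) ∈ groupVN Γ K) :
    HasSum (fun g => ‖τ (coef α v g)‖ ^ 2) (norm₂ (crossedTrace α τ) v ^ 2) := by
  refine (hasSum_coef_re hτ v).congr_fun fun g => ?_
  rw [coef_eq_smul_one hτ hα hv g]
  simp only [star_smul, star_one, smul_mul_smul_comm, mul_one, map_smul, hτ.normalised, smul_eq_mul,
    RCLike.star_def, Complex.conj_mul']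
  norm_cast

/-- Moving `λ(g)` past `π(a)` and cycling the trace collects `α_g(a)` and `b` into one element of
`π(B)`, independent of `λ(g) w`. -/
theorem crossedTrace_lamM_mul_condExp (hτ : IsTrace B τ) (hα : ∀ g b, τ (α g b) = τ b)
    {E : (crossedProduct α).toStarSubalgebra → (crossedProduct α).toStarSubalgebra}
    (hE : IsCondExp (crossedTrace α τ) (groupVN Γ K) E) {w : (crossedProduct α).toStarSubalgebra}
    (hw : (w : L2 Γ K →L[ℂ] L2 Γ K) ∈ groupVN Γ K) (a b : B.toStarSubalgebra) (g : Γ) :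
    crossedTrace α τ (lamM α g * E (piM α a * w * piM α b)) =
      τ (α g a * b) * crossedTrace α τ (lamM α g * w) := by
  have hT := crossedTrace_isTrace hτ hα
  have e : lamM α g * (piM α a * w * piM α b) = piM α (α g a) * (lamM α g * w * piM α b) := by
    rw [← mul_assoc, ← mul_assoc, lamM_mul_piM]
    simp only [mul_assoc]
  rw [hT.tracial, hE.2 _ _ (lamM_mem α g), hT.tracial, e, hT.tracial, mul_assoc, piM_mul_piM,
    hT.tracial, crossedTrace_piM_mul hτ hα _ (mul_mem (lamM_mem α g) hw), hτ.tracial]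

/-- By `A`-linearity of `E` the defect is `u d`, with `d = E(π(a) u* π(b)) - τ(a) τ(b) u*`. The
unitary does not change the 2-norm, and the coefficients of `d` are those of `u*` times the
correlations. -/
theorem hasSum_defect_piM (hτ : IsTrace B τ) (hα : ∀ g b, τ (α g b) = τ b)
    {E : (crossedProduct α).toStarSubalgebra → (crossedProduct α).toStarSubalgebra}
    (hE : IsCondExp (crossedTrace α τ) (groupVN Γ K) E)
    {u : unitary (crossedProduct α).toStarSubalgebra}
    (hu : ((u : (crossedProduct α).toStarSubalgebra) : L2 Γ K →L[ℂ] L2 Γ K) ∈ groupVN Γ K)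
    (a b : B.toStarSubalgebra) :
    HasSum (fun g => ‖τ (coef α (star (u : (crossedProduct α).toStarSubalgebra)) g)‖ ^ 2 *
      ‖τ (α g⁻¹ a * b) - τ a * τ b‖ ^ 2)
        (norm₂ (crossedTrace α τ) (defect E u (piM α a) (piM α b)) ^ 2) := by
  have hT := crossedTrace_isTrace hτ hα
  set w : (crossedProduct α).toStarSubalgebra := star (u : (crossedProduct α).toStarSubalgebra)
    with hw
  have hwA : (w : L2 Γ K →L[ℂ] L2 Γ K) ∈ groupVN Γ K := star_mem hu
  have hEpi : ∀ c, E (piM α c) = τ c • (1 : (crossedProduct α).toStarSubalgebra) := fun c =>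
    hE.eq_of_forall hT ((groupVN Γ K).toStarSubalgebra.smul_mem (one_mem _) _) fun v hv => by
      rw [crossedTrace_piM_mul hτ hα c hv, smul_mul_assoc, one_mul, map_smul, smul_eq_mul]
  set d := E (piM α a * w * piM α b) - (τ a * τ b) • w with hd
  have hdA : (d : L2 Γ K →L[ℂ] L2 Γ K) ∈ groupVN Γ K :=
    sub_mem (hE.1 _) ((groupVN Γ K).toStarSubalgebra.smul_mem hwA _)
  have hdefect : defect E u (piM α a) (piM α b) = (u : (crossedProduct α).toStarSubalgebra) * d := by
    have e1 : defect E u (piM α a) (piM α b) =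
        E ((u : (crossedProduct α).toStarSubalgebra) * (piM α a * w * piM α b)) -
          E (piM α a) * E (piM α b) := by
      rw [← mul_assoc, ← mul_assoc]
      rfl
    have e2 : (u : (crossedProduct α).toStarSubalgebra) * w = 1 := Unitary.coe_mul_star_self u
    rw [e1, hE.map_mul_left hT hu, hd, mul_sub, mul_smul_comm, e2, hEpi, hEpi, smul_mul_smul_comm,
      mul_one]
  have hcoef : ∀ g, τ (coef α d g) = τ (coef α w g) * (τ (α g⁻¹ a * b) - τ a * τ b) := by
    intro g
    have e1 := crossedTrace_lamM_mul_condExp hτ hα hE hwA a b g⁻¹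
    have e2 := crossedTrace_lamM_mul α τ d g⁻¹
    have e3 := crossedTrace_lamM_mul α τ w g⁻¹
    rw [inv_inv] at e2 e3
    rw [← e2, hd, map_mul_sub_smul, e1, e3]
    ring
  rw [hdefect, IsTrace.norm₂_mul_of_star_mul_self (Unitary.coe_star_mul_self u)]
  refine (hasSum_norm_sq_coef hτ hα hdA).congr_fun fun g => ?_
  rw [hcoef, norm_mul, mul_pow]

theorem hasSum_norm_sq_coef_star (hτ : IsTrace B τ) (hα : ∀ g b, τ (α g b) = τ b)
    {u : unitary (crossedProduct α).toStarSubalgebra}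
    (hu : ((u : (crossedProduct α).toStarSubalgebra) : L2 Γ K →L[ℂ] L2 Γ K) ∈ groupVN Γ K) :
    HasSum (fun g => ‖τ (coef α (star (u : (crossedProduct α).toStarSubalgebra)) g)‖ ^ 2) 1 := by
  have h := hasSum_norm_sq_coef hτ hα
    (v := star (u : (crossedProduct α).toStarSubalgebra)) (star_mem hu)
  rwa [(crossedTrace_isTrace hτ hα).norm₂_star, norm₂, Unitary.coe_star_mul_self,
    (crossedTrace_isTrace hτ hα).normalised, Complex.one_re, Real.sqrt_one, one_pow] at h

/-- Puts the weights, which are coefficients of `u*`, into the form `τ(u x)` that almost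
orthonormality controls. -/
theorem norm_coef_star (hτ : IsTrace B τ) (hα : ∀ g b, τ (α g b) = τ b)
    (x : (crossedProduct α).toStarSubalgebra) (g : Γ) :
    ‖τ (coef α (star x) g)‖ = ‖crossedTrace α τ (x * lamM α g)‖ := by
  have e := crossedTrace_lamM_mul α τ (star x) g⁻¹
  rw [inv_inv] at e
  rw [← e, ← star_lamM, ← star_mul, (crossedTrace_isTrace hτ hα).norm_map_star]

theorem tendsto_norm_sq {ι : Type*} {l : Filter ι} {f : ι → ℂ} (h : Tendsto f l (𝓝 0)) :
    Tendsto (fun i => ‖f i‖ ^ 2) l (𝓝 0) := by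
  simpa using h.norm.pow 2

/-- The squared norm is an average of squared correlations. Its weights sum to `1` by unitarity and
each tends to `0` by almost orthonormality tested on `λ(g)`. -/
theorem mixesPair_piM (hτ : IsTrace B τ) (hα : ∀ g b, τ (α g b) = τ b)
    (hmix : StronglyMixingAction α τ)
    {E : (crossedProduct α).toStarSubalgebra → (crossedProduct α).toStarSubalgebra}
    (hE : IsCondExp (crossedTrace α τ) (groupVN Γ K) E)
    {G : Subgroup (unitary (crossedProduct α).toStarSubalgebra)}
    (hG : ∀ u ∈ G, ((u : (crossedProduct α).toStarSubalgebra) : L2 Γ K →L[ℂ] L2 Γ K) ∈ groupVN Γ K)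
    (hao : AlmostOrthonormal (crossedTrace α τ)
      (G : Set (unitary (crossedProduct α).toStarSubalgebra))) (a b : B.toStarSubalgebra) :
    MixesPair (crossedTrace α τ) E G (piM α a) (piM α b) := by
  have hT := crossedTrace_isTrace hτ hα
  have hsq : Tendsto (fun u : G =>
      norm₂ (crossedTrace α τ) (defect E u (piM α a) (piM α b)) ^ 2) cofinite (𝓝 0) := by
    refine tendsto_weighted_sum_zero (fun _ _ => by positivity) (fun u => ?_) (fun g => ?_)
      (fun _ => by positivity) ?_ (fun u => hasSum_defect_piM hτ hα hE (hG u u.2) a b)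
    · exact hasSum_norm_sq_coef_star hτ hα (hG u u.2)
    · refine (tendsto_norm_sq (hao.tendsto (lamM α g))).congr fun u => ?_
      rw [norm_coef_star hτ hα]
    · exact tendsto_norm_sq ((stronglyMixingAction_iff.1 hmix a b).comp
        (inv_injective (G := Γ)).tendsto_cofinite)
  have h := hsq.sqrt
  rw [Real.sqrt_zero] at h
  exact h.congr fun u => Real.sqrt_sq (norm₂_nonneg _)

theorem stronglyMixingRel_of_stronglyMixingAction (hτ : IsTrace B τ)
    (hα : ∀ g b, τ (α g b) = τ b) (hmix : StronglyMixingAction α τ)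
    {E : (crossedProduct α).toStarSubalgebra → (crossedProduct α).toStarSubalgebra}
    (hE : IsCondExp (crossedTrace α τ) (groupVN Γ K) E)
    {G : Subgroup (unitary (crossedProduct α).toStarSubalgebra)}
    (hG : ∀ u ∈ G, ((u : (crossedProduct α).toStarSubalgebra) : L2 Γ K →L[ℂ] L2 Γ K) ∈ groupVN Γ K)
    (hao : AlmostOrthonormal (crossedTrace α τ)
      (G : Set (unitary (crossedProduct α).toStarSubalgebra))) :
    StronglyMixingRel (crossedTrace α τ) E G := by
  have hT := crossedTrace_isTrace hτ hα
  have hXM : ∀ v ∈ monomials α, v ∈ crossedProduct α := by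
    rintro _ ⟨p, rfl⟩
    exact (lamM α p.1 * piM α p.2).2
  have hcases : ∀ z ∈ {v : (crossedProduct α).toStarSubalgebra |
      (v : L2 Γ K →L[ℂ] L2 Γ K) ∈ monomials α}, ∃ g b, z = lamM α g * piM α b := by
    rintro z ⟨p, hp⟩
    exact ⟨p.1, p.2, Subtype.ext hp.symm⟩
  have hright : ∀ a y, MixesPair (crossedTrace α τ) E G (piM α a) y := fun a y =>
    MixesPair.of_approx_right hE hT fun ε hε => by
      obtain ⟨y', hy', hlt⟩ := (isStable_monomials α).exists_norm₂_sub_lt hT.normal hXM y y.2 hε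
      refine ⟨y', MixesPair.span_right hE hT (fun z hz => ?_) hy', hlt⟩
      obtain ⟨g, b, rfl⟩ := hcases z hz
      -- In the second variable factors from `A` come out on the right, so `λ(g)` is moved there. In
      -- the first variable they come out on the left, since they commute with `u`.
      rw [lamM_mul_piM]
      exact (mixesPair_piM hτ hα hmix hE hG hao a _).mul_right hE hT (lamM_mem α g)
  intro x y
  refine MixesPair.of_approx_left hE hT fun ε hε => ?_
  obtain ⟨x', hx', hlt⟩ := (isStable_monomials α).exists_norm₂_sub_lt hT.normal hXM x x.2 hε
  refine ⟨x', MixesPair.span_left hE hT (fun z hz => ?_) hx', hlt⟩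
  obtain ⟨g, a, rfl⟩ := hcases z hz
  exact (hright a y).mul_left hE hT (lamM_mem α g) fun u hu => lamM_comm (hG u hu) g

end Mixing

end

end CrossedMixing

theorem proposition3p6
    {K : Type*} [NormedAddCommGroup K] [InnerProductSpace ℂ K] [CompleteSpace K]
    (B : VonNeumannAlgebra K) (τ : B.toStarSubalgebra →ₗ[ℂ] ℂ)
    (hτ : CrossedMixing.IsTrace B τ)
    {Γ : Type*} [CommGroup Γ]
    (α : Γ →* (B.toStarSubalgebra ≃⋆ₐ[ℂ] B.toStarSubalgebra))
    (hα : ∀ (g : Γ) (b : B.toStarSubalgebra), τ (α g b) = τ b) :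
    CrossedMixing.StronglyMixingIn (CrossedMixing.crossedTrace α τ) (CrossedMixing.groupVN Γ K) ↔
      CrossedMixing.StronglyMixingAction α τ :=
  ⟨CrossedMixing.stronglyMixingAction_of_stronglyMixingIn hτ hα, fun h =>
    ⟨CrossedMixing.condExp hτ hα, CrossedMixing.isCondExp_condExp hτ hα, fun _ hG hao =>
      CrossedMixing.stronglyMixingRel_of_stronglyMixingAction hτ hα h
        (CrossedMixing.isCondExp_condExp hτ hα) hG hao⟩⟩
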